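/- Let $n\in\mathbb N$, let $\mathbb B_n$ be the open unit ball of $\mathbb C^n$ and $v_n$ the normalized volume measure on $\mathbb B_n$. Let $L_a^2(\mathbb B_n)$ be the Bergman space, i.e. the Hilbert space of holomorphic functions on $\mathbb B_n$ that are square integrable with respect to $v_n$, with the norm $\|f\|^2=\int_{\mathbb B_n}|f|^2\,dv_n$. For $g\in L^\infty(\mathbb B_n)$ let $T_g f=P_{L_a^2}(gf)$ be the Toeplitz operator on $L_a^2(\mathbb B_n)$, where $P_{L_a^2}$ is the orthogonal projection of $L^2(\mathbb B_n,v_n)$ onto $L_a^2(\mathbb B_n)$, and let $\mathcal T(L^\infty)$ be the $C^*$-subalgebra of the bounded operators $B(L_a^2(\mathbb B_n))$ generated by all $T_g$, $g\in L^\infty(\mathbb B_n)$. Let $M\subseteq\mathbb B_n$ be any subset, $P=\{f\in L_a^2(\mathbb B_n): f|_M=0\}$ and $Q=P^\perp$. Suppose that there is a positive, finite, regular Borel measure $\mu$ on $M$ such that the $L^2(\mu)$ norm and the Bergman norm are equivalent on $Q$, i.e. there are constants $C,c>0$ with $$c\|f\|^2\le\int_M|f(w)|^2\,d\mu(w)\le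 C\|f\|^2\qquad\text{for all } f\in Q.$$ Then the orthogonal projections of $L_a^2(\mathbb B_n)$ onto $P$ and onto $Q$ both belong to $\mathcal T(L^\infty)$. -/

import Mathlib

open MeasureTheory Metric
open scoped ENNReal

namespace BergmanBall

/-- The space `ℂⁿ` with its Euclidean norm. -/
abbrev Cn (n : ℕ) : Type := EuclideanSpace ℂ (Fin n)

/-- The open unit ball of `ℂⁿ`. -/
abbrev unitBall (n : ℕ) : Set (Cn n) := ball 0 1

/-- The normalized volume measure on the unit ball, as a measure on `ℂⁿ` carried by the ball. -/
noncomputable def ballMeasure (n : ℕ) : Measure (Cn n) :=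
  (volume (unitBall n))⁻¹ • volume.restrict (unitBall n)

theorem volume_unitBall_ne_zero (n : ℕ) : volume (unitBall n) ≠ 0 :=
  (measure_ball_pos volume _ one_pos).ne'

theorem volume_unitBall_ne_top (n : ℕ) : volume (unitBall n) ≠ ∞ := measure_ball_lt_top.ne

instance (n : ℕ) : IsProbabilityMeasure (ballMeasure n) :=
  ⟨by simp [ballMeasure, ENNReal.inv_mul_cancel (volume_unitBall_ne_zero n)
    (volume_unitBall_ne_top n)]⟩

theorem restrict_eq_smul (n : ℕ) :
    volume.restrict (unitBall n) = volume (unitBall n) • ballMeasure n := by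
  rw [ballMeasure, smul_smul, ENNReal.mul_inv_cancel (volume_unitBall_ne_zero n)
    (volume_unitBall_ne_top n), one_smul]

theorem ae_ballMeasure_iff {n : ℕ} {p : Cn n → Prop} :
    (∀ᵐ w ∂(ballMeasure n), p w) ↔ ∀ᵐ w ∂(volume.restrict (unitBall n)), p w := by
  constructor <;> intro h
  · rw [restrict_eq_smul]
    exact Measure.ae_smul_measure h _
  · exact Measure.ae_smul_measure h _

/-- The Bergman space: the square integrable holomorphic functions on the unit ball, as a
subspace of `L²` of the normalized volume measure. -/
def bergmanSpace (n : ℕ) : Submodule ℂ (Lp ℂ 2 (ballMeasure n)) where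
  carrier := {f | ∃ F : Cn n → ℂ, DifferentiableOn ℂ F (unitBall n) ∧ f =ᵐ[ballMeasure n] F}
  add_mem' := by
    rintro f g ⟨F, hF, hfF⟩ ⟨G, hG, hgG⟩
    exact ⟨F + G, hF.add hG, (Lp.coeFn_add f g).trans (hfF.add hgG)⟩
  zero_mem' := ⟨0, differentiableOn_const 0, Lp.coeFn_zero _ _ _⟩
  smul_mem' := by
    rintro c f ⟨F, hF, hfF⟩
    exact ⟨c • F, hF.const_smul c, (Lp.coeFn_smul c f).trans (hfF.const_smul c)⟩

section

variable {n : ℕ}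

/-- The Bergman space as a Hilbert space in its own right. -/
def Bergman (n : ℕ) : Type := bergmanSpace n

noncomputable instance : NormedAddCommGroup (Bergman n) :=
  inferInstanceAs (NormedAddCommGroup (bergmanSpace n))

noncomputable instance : InnerProductSpace ℂ (Bergman n) :=
  inferInstanceAs (InnerProductSpace ℂ (bergmanSpace n))

/-- The inclusion of the Bergman space into `L²`. -/
noncomputable def toLp : Bergman n →ₗᵢ[ℂ] Lp ℂ 2 (ballMeasure n) :=
  (bergmanSpace n).subtypeₗᵢ

/-- Every element of the Bergman space is a holomorphic function, up to a null set. -/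
theorem mem_bergmanSpace (f : Bergman n) :
    ∃ F : Cn n → ℂ, DifferentiableOn ℂ F (unitBall n) ∧ toLp f =ᵐ[ballMeasure n] F :=
  f.2

/-- The holomorphic function on the unit ball that an element of the Bergman space is
(extended by zero outside the ball). -/
noncomputable def holo (f : Bergman n) : Cn n → ℂ :=
  (unitBall n).indicator (Classical.choose (mem_bergmanSpace f))

theorem holo_differentiableOn (f : Bergman n) :
    DifferentiableOn ℂ (holo f) (unitBall n) :=
  (Classical.choose_spec (mem_bergmanSpace f)).1.congr fun _ hz => Set.indicator_of_mem hz _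

theorem ae_eq_holo (f : Bergman n) :
    toLp f =ᵐ[ballMeasure n] holo f := by
  refine (Classical.choose_spec (mem_bergmanSpace f)).2.trans ?_
  refine ae_ballMeasure_iff.2 ?_
  filter_upwards [ae_restrict_mem measurableSet_ball] with z hz
  exact (Set.indicator_of_mem hz _).symm

theorem holo_of_notMem (f : Bergman n) {z : Cn n} (hz : z ∉ unitBall n) : holo f z = 0 :=
  Set.indicator_of_notMem hz _

/-- The holomorphic representative is unique on the ball. -/
theorem holo_eq_of_ae_eq (f : Bergman n) {F : Cn n → ℂ}
    (hF : DifferentiableOn ℂ F (unitBall n))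
    (h : toLp f =ᵐ[ballMeasure n] F) {z : Cn n} (hz : z ∈ unitBall n) :
    holo f z = F z :=
  Measure.eqOn_open_of_ae_eq (μ := volume) (ae_ballMeasure_iff.1 ((ae_eq_holo f).symm.trans h))
    isOpen_ball (holo_differentiableOn f).continuousOn hF.continuousOn hz

theorem holo_add (f g : Bergman n) (z : Cn n) : holo (f + g) z = holo f z + holo g z := by
  by_cases hz : z ∈ unitBall n
  · exact holo_eq_of_ae_eq (f + g) ((holo_differentiableOn f).add (holo_differentiableOn g))
      ((Lp.coeFn_add _ _).trans ((ae_eq_holo f).add (ae_eq_holo g))) hz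
  · simp [holo_of_notMem _ hz]

theorem holo_smul (c : ℂ) (f : Bergman n) (z : Cn n) : holo (c • f) z = c * holo f z := by
  by_cases hz : z ∈ unitBall n
  · exact holo_eq_of_ae_eq (c • f) ((holo_differentiableOn f).const_smul c)
      ((Lp.coeFn_smul _ _).trans ((ae_eq_holo f).const_smul c)) hz
  · simp [holo_of_notMem _ hz]

theorem holo_zero (z : Cn n) : holo (0 : Bergman n) z = 0 := by
  simpa using holo_smul 0 (0 : Bergman n) z

theorem holo_sub (f g : Bergman n) (z : Cn n) : holo (f - g) z = holo f z - holo g z := by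
  have h := holo_add (f - g) g z
  rw [sub_add_cancel] at h
  rw [h, add_sub_cancel_right]

/-- Rotation invariance of the volume of a ball. -/
theorem integral_rotate {r : ℝ} {u : ℂ} (hu : ‖u‖ = 1) (G : Cn n → ℂ) :
    ∫ w in closedBall (0 : Cn n) r, G (u • w) = ∫ w in closedBall (0 : Cn n) r, G w := by
  have hu0 : u ≠ 0 := by
    rintro rfl
    simp at hu
  let e : Cn n ≃ₗᵢ[ℝ] Cn n :=
    { toLinearEquiv := (LinearEquiv.smulOfNeZero ℂ (Cn n) u hu0).restrictScalars ℝ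
      norm_map' := fun x => by
        change ‖u • x‖ = ‖x‖
        rw [norm_smul, hu, one_mul] }
  have h := (e.measurePreserving).setIntegral_preimage_emb
    e.toHomeomorph.measurableEmbedding G (closedBall (0 : Cn n) r)
  have hpre : (e : Cn n → Cn n) ⁻¹' closedBall (0 : Cn n) r = closedBall (0 : Cn n) r := by
    ext x
    rw [Set.mem_preimage, mem_closedBall_zero_iff, mem_closedBall_zero_iff, e.norm_map]
  rw [hpre] at h
  exact h

/-- The mean value property over balls. -/
theorem mean_value {F : Cn n → ℂ} (hF : DifferentiableOn ℂ F (unitBall n)) {z : Cn n} {r : ℝ}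
    (hz : closedBall z r ⊆ unitBall n) :
    ∫ w in closedBall (0 : Cn n) r, F (z + w) =
      (volume.real (closedBall (0 : Cn n) r) : ℂ) * F z := by
  have hmem : ∀ w ∈ closedBall (0 : Cn n) r, ∀ t : ℂ, ‖t‖ ≤ 1 → z + t • w ∈ unitBall n := by
    intro w hw t ht
    apply hz
    rw [mem_closedBall_zero_iff] at hw
    rw [mem_closedBall, dist_eq_norm, add_sub_cancel_left, norm_smul]
    nlinarith [norm_nonneg w, norm_nonneg t]
  have hnorm : ∀ θ : ℝ, ‖circleMap 0 1 θ‖ = 1 := fun θ => by simp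
  have hcirc : ∀ w ∈ closedBall (0 : Cn n) r,
      ∫ θ in (0 : ℝ)..2 * Real.pi, F (z + circleMap 0 1 θ • w) = (2 * Real.pi : ℝ) * F z := by
    intro w hw
    have hd : DifferentiableOn ℂ (fun t : ℂ => F (z + t • w)) (closedBall 0 1) := by
      refine hF.comp ?_ fun t ht => hmem w hw t (by simpa using ht)
      fun_prop
    have hav := DiffContOnCl.circleAverage (f := fun t : ℂ => F (z + t • w)) (c := 0) (R := 1)
      (by
        rw [abs_one]
        exact (hd.mono (closure_ball_subset_closedBall)).diffContOnCl)
    rw [Real.circleAverage_def] at hav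
    simp only [zero_smul, add_zero] at hav
    rw [← hav]
    have hpi : (2 * Real.pi : ℝ) ≠ 0 := by positivity
    rw [Complex.real_smul, ← mul_assoc, ← Complex.ofReal_mul, mul_inv_cancel₀ hpi]
    simp
  have hrot : ∀ θ : ℝ, ∫ w in closedBall (0 : Cn n) r, F (z + circleMap 0 1 θ • w) =
      ∫ w in closedBall (0 : Cn n) r, F (z + w) := fun θ =>
    integral_rotate (hnorm θ) fun w => F (z + w)
  have hint : IntegrableOn (fun p : Cn n × ℝ => F (z + circleMap 0 1 p.2 • p.1))
      (closedBall (0 : Cn n) r ×ˢ Set.uIcc 0 (2 * Real.pi)) (volume.prod volume) := by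
    refine ContinuousOn.integrableOn_compact
      ((isCompact_closedBall _ _).prod isCompact_uIcc) ?_
    refine hF.continuousOn.comp ?_ fun p hp => hmem p.1 hp.1 _ (hnorm p.2).le
    have : Continuous fun p : Cn n × ℝ => z + circleMap 0 1 p.2 • p.1 :=
      continuous_const.add (((continuous_circleMap 0 1).comp continuous_snd).smul continuous_fst)
    exact this.continuousOn
  have hswap : ∫ w in closedBall (0 : Cn n) r,
        ∫ θ in (0 : ℝ)..2 * Real.pi, F (z + circleMap 0 1 θ • w) =
      ∫ θ in (0 : ℝ)..2 * Real.pi,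
        ∫ w in closedBall (0 : Cn n) r, F (z + circleMap 0 1 θ • w) := by
    have h2 : (0 : ℝ) ≤ 2 * Real.pi := by positivity
    simp only [intervalIntegral.integral_of_le h2]
    refine integral_integral_swap
      (f := fun (w : Cn n) (θ : ℝ) => F (z + circleMap 0 1 θ • w)) ?_
    rw [Measure.prod_restrict]
    refine hint.mono_set ?_
    rw [Set.uIcc_of_le h2]
    exact Set.prod_mono le_rfl Set.Ioc_subset_Icc_self
  rw [setIntegral_congr_fun measurableSet_closedBall hcirc] at hswap
  simp only [hrot, intervalIntegral.integral_const, setIntegral_const, sub_zero] at hswap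
  have hpi : ((2 * Real.pi : ℝ) : ℂ) ≠ 0 := by
    exact_mod_cast (by positivity : (2 * Real.pi : ℝ) ≠ 0)
  rw [Complex.real_smul, Complex.real_smul] at hswap
  apply mul_left_cancel₀ hpi
  rw [← hswap]
  ring

theorem integrable_holo (f : Bergman n) : IntegrableOn (holo f) (unitBall n) := by
  rw [IntegrableOn, restrict_eq_smul]
  refine Integrable.smul_measure ?_ (volume_unitBall_ne_top n)
  exact (integrable_congr (ae_eq_holo f)).1
    ((Lp.memLp (toLp f)).integrable (by norm_num))

theorem setIntegral_norm_holo_le (f : Bergman n) :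
    ∫ w in unitBall n, ‖holo f w‖ ≤ volume.real (unitBall n) * ‖f‖ := by
  rw [restrict_eq_smul, integral_smul_measure, Measure.real, smul_eq_mul]
  refine mul_le_mul_of_nonneg_left ?_ ENNReal.toReal_nonneg
  have hm : MemLp (toLp f) 2 (ballMeasure n) := Lp.memLp _
  have hi : ∫ w, ‖holo f w‖ ∂(ballMeasure n) =
      ∫ w, ‖toLp f w‖ ∂(ballMeasure n) :=
    integral_congr_ae ((ae_eq_holo f).symm.fun_comp norm)
  rw [hi, integral_norm_eq_lintegral_enorm hm.aestronglyMeasurable, ← eLpNorm_one_eq_lintegral_enorm,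
    ← (toLp (n := n)).norm_map f, Lp.norm_def]
  exact ENNReal.toReal_mono hm.eLpNorm_ne_top
    (eLpNorm_le_eLpNorm_of_exponent_le (by norm_num) hm.aestronglyMeasurable)

/-- Point evaluations are bounded, locally uniformly. -/
theorem norm_holo_le (f : Bergman n) {z : Cn n} {r : ℝ} (hr : 0 < r)
    (hz : closedBall z r ⊆ unitBall n) :
    ‖holo f z‖ ≤ volume.real (unitBall n) / volume.real (closedBall (0 : Cn n) r) * ‖f‖ := by
  have hV : 0 < volume.real (closedBall (0 : Cn n) r) :=
    ENNReal.toReal_pos (measure_closedBall_pos volume _ hr).ne' measure_closedBall_lt_top.ne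
  rw [div_mul_eq_mul_div, le_div_iff₀ hV]
  have hmv := congrArg norm (mean_value (holo_differentiableOn f) hz)
  rw [norm_mul, Complex.norm_real, Real.norm_of_nonneg hV.le] at hmv
  have htr : ∫ w in closedBall (0 : Cn n) r, ‖holo f (z + w)‖ =
      ∫ w in closedBall z r, ‖holo f w‖ := by
    have h := (measurePreserving_add_left volume z).setIntegral_preimage_emb
      (measurableEmbedding_addLeft z) (fun w => ‖holo f w‖) (closedBall z r)
    rw [← h]
    simp
  calc ‖holo f z‖ * volume.real (closedBall (0 : Cn n) r)
      = ‖∫ w in closedBall (0 : Cn n) r, holo f (z + w)‖ := by rw [hmv, mul_comm]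
    _ ≤ ∫ w in closedBall (0 : Cn n) r, ‖holo f (z + w)‖ := norm_integral_le_integral_norm _
    _ = ∫ w in closedBall z r, ‖holo f w‖ := htr
    _ ≤ ∫ w in unitBall n, ‖holo f w‖ :=
        setIntegral_mono_set (integrable_holo f).norm
          (Filter.Eventually.of_forall fun _ => norm_nonneg _) hz.eventuallyLE
    _ ≤ _ := setIntegral_norm_holo_le f

/-- Derivatives at points are bounded, locally uniformly. -/
theorem norm_fderiv_holo_le (f : Bergman n) {z : Cn n} {r : ℝ} (hr : 0 < r)
    (hz : closedBall z (r + r) ⊆ unitBall n) :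
    ‖fderiv ℂ (holo f) z‖ ≤
      volume.real (unitBall n) / volume.real (closedBall (0 : Cn n) r) * ‖f‖ / r := by
  set K := volume.real (unitBall n) / volume.real (closedBall (0 : Cn n) r) * ‖f‖
  have hK : 0 ≤ K := by positivity
  have hzb : z ∈ unitBall n := hz (mem_closedBall_self (by positivity))
  have hb : ∀ w ∈ closedBall z r, ‖holo f w‖ ≤ K := by
    intro w hw
    refine norm_holo_le f hr (subset_trans ?_ hz)
    exact closedBall_subset_closedBall' (by linarith [mem_closedBall.1 hw])
  refine ContinuousLinearMap.opNorm_le_bound _ (by positivity) fun v => ?_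
  rcases eq_or_ne v 0 with rfl | hv
  · simp
  have hv' : 0 < ‖v‖ := norm_pos_iff.2 hv
  have hR : 0 < r / ‖v‖ := by positivity
  have hmem : ∀ t ∈ closedBall (0 : ℂ) (r / ‖v‖), z + t • v ∈ closedBall z r := by
    intro t ht
    rw [mem_closedBall_zero_iff, le_div_iff₀ hv'] at ht
    rwa [mem_closedBall, dist_eq_norm, add_sub_cancel_left, norm_smul]
  have hsub : closedBall z r ⊆ unitBall n :=
    (closedBall_subset_closedBall (by linarith)).trans hz
  have hd : DifferentiableOn ℂ (fun t : ℂ => holo f (z + t • v)) (closedBall 0 (r / ‖v‖)) := by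
    refine (holo_differentiableOn f).comp ?_ fun t ht => hsub (hmem t ht)
    fun_prop
  have hder := Complex.norm_deriv_le_of_forall_mem_sphere_norm_le hR
    (hd.mono closure_ball_subset_closedBall).diffContOnCl
    (fun t ht => hb _ (hmem t (sphere_subset_closedBall ht)))
  have hfd : HasFDerivAt (holo f) (fderiv ℂ (holo f) z) (z + (0 : ℂ) • v) := by
    rw [zero_smul, add_zero]
    exact ((holo_differentiableOn f).differentiableAt (isOpen_ball.mem_nhds hzb)).hasFDerivAt
  have hline : HasDerivAt (fun t : ℂ => z + t • v) v 0 := by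
    simpa using ((hasDerivAt_id (0 : ℂ)).smul_const v).const_add z
  have hcomp : HasDerivAt (fun t : ℂ => holo f (z + t • v)) (fderiv ℂ (holo f) z v) 0 :=
    hfd.comp_hasDerivAt (0 : ℂ) hline
  rw [hcomp.deriv] at hder
  calc ‖fderiv ℂ (holo f) z v‖ ≤ K / (r / ‖v‖) := hder
    _ = K / r * ‖v‖ := by field_simp

theorem exists_norm_holo_le (z : Cn n) :
    ∃ C : ℝ, ∀ f : Bergman n, ‖holo f z‖ ≤ C * ‖f‖ := by
  by_cases hz : z ∈ unitBall n
  · obtain ⟨r, hr, h⟩ := nhds_basis_closedBall.mem_iff.1 (isOpen_ball.mem_nhds hz)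
    exact ⟨_, fun f => norm_holo_le f hr h⟩
  · exact ⟨0, fun f => by simp [holo_of_notMem f hz]⟩

theorem fderiv_holo_sub (f g : Bergman n) {z : Cn n} (hz : z ∈ unitBall n) :
    fderiv ℂ (holo (f - g)) z = fderiv ℂ (holo f) z - fderiv ℂ (holo g) z := by
  have h : holo (f - g) = holo f - holo g := funext (holo_sub f g)
  rw [h]
  exact fderiv_sub ((holo_differentiableOn f).differentiableAt (isOpen_ball.mem_nhds hz))
    ((holo_differentiableOn g).differentiableAt (isOpen_ball.mem_nhds hz))

/-- The Bergman space is closed in `L²`. -/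
theorem isClosed_bergmanSpace : IsClosed (bergmanSpace n : Set (Lp ℂ 2 (ballMeasure n))) := by
  refine IsSeqClosed.isClosed fun x g hx hlim => ?_
  let f : ℕ → Bergman n := fun k => ⟨x k, hx k⟩
  have hC : ∀ ε > 0, ∃ N, ∀ k ≥ N, ∀ l ≥ N, ‖f k - f l‖ < ε := by
    intro ε hε
    obtain ⟨N, hN⟩ := Metric.cauchySeq_iff.1 hlim.cauchySeq ε hε
    refine ⟨N, fun k hk l hl => ?_⟩
    have := hN k hk l hl
    rwa [dist_eq_norm] at this
  have hpt : ∀ z : Cn n, ∃ c, Filter.Tendsto (fun k => holo (f k) z) Filter.atTop (nhds c) := by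
    intro z
    obtain ⟨C, hCz⟩ := exists_norm_holo_le z
    refine cauchySeq_tendsto_of_complete (Metric.cauchySeq_iff.2 fun ε hε => ?_)
    obtain ⟨N, hN⟩ := hC (ε / (|C| + 1)) (by positivity)
    refine ⟨N, fun k hk l hl => ?_⟩
    rw [dist_eq_norm, ← holo_sub]
    have h1 := hN k hk l hl
    rw [lt_div_iff₀ (by positivity)] at h1
    nlinarith [hCz (f k - f l), le_abs_self C, norm_nonneg (f k - f l)]
  choose F hF using hpt
  refine ⟨F, fun z hz => ?_, ?_⟩
  · obtain ⟨ρ, hρ, hsub⟩ := nhds_basis_closedBall.mem_iff.1 (isOpen_ball.mem_nhds hz)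
    set r := ρ / 3 with hr_def
    have hr : 0 < r := by positivity
    have hy : ∀ y ∈ ball z r, closedBall y (r + r) ⊆ unitBall n := fun y hy =>
      (closedBall_subset_closedBall' (by linarith [mem_ball.1 hy])).trans hsub
    have hyb : ∀ y ∈ ball z r, y ∈ unitBall n := fun y hyr =>
      hy y hyr (mem_closedBall_self (by positivity))
    set K := volume.real (unitBall n) / volume.real (closedBall (0 : Cn n) r)
    have hK : 0 ≤ K := by positivity
    have hUC : UniformCauchySeqOn (fun k => fderiv ℂ (holo (f k))) Filter.atTop (ball z r) := by
      refine Metric.uniformCauchySeqOn_iff.2 fun ε hε => ?_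
      obtain ⟨N, hN⟩ := hC (ε * r / (K + 1)) (by positivity)
      refine ⟨N, fun k hk l hl y hyr => ?_⟩
      rw [dist_eq_norm, ← fderiv_holo_sub _ _ (hyb y hyr)]
      refine (norm_fderiv_holo_le (f k - f l) hr (hy y hyr)).trans_lt ?_
      have h1 := hN k hk l hl
      rw [lt_div_iff₀ (by positivity)] at h1
      rw [div_lt_iff₀ hr]
      nlinarith [norm_nonneg (f k - f l)]
    have hpt' : ∀ y : Cn n, ∃ A, y ∈ ball z r →
        Filter.Tendsto (fun k => fderiv ℂ (holo (f k)) y) Filter.atTop (nhds A) := by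
      intro y
      by_cases hyr : y ∈ ball z r
      · obtain ⟨A, hA⟩ := cauchySeq_tendsto_of_complete (hUC.cauchySeq hyr)
        exact ⟨A, fun _ => hA⟩
      · exact ⟨0, fun h => absurd h hyr⟩
    choose G hG using hpt'
    have hT := hUC.tendstoUniformlyOn_of_tendsto hG
    have := hasFDerivAt_of_tendstoUniformlyOn isOpen_ball hT
      (fun k y hyr => ((holo_differentiableOn (f k)).differentiableAt
        (isOpen_ball.mem_nhds (hyb y hyr))).hasFDerivAt) (fun y _ => hF y) (mem_ball_self hr)
    exact this.differentiableAt.differentiableWithinAt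
  · obtain ⟨ns, hns, hae⟩ := (tendstoInMeasure_of_tendsto_Lp hlim).exists_seq_tendsto_ae
    have hall : ∀ᵐ w ∂(ballMeasure n), ∀ k, x k w = holo (f k) w :=
      ae_all_iff.2 fun k => ae_eq_holo (f k)
    filter_upwards [hae, hall] with w hw hw'
    refine tendsto_nhds_unique hw ?_
    simp only [hw']
    exact (hF w).comp hns.tendsto_atTop

instance : CompleteSpace (bergmanSpace n) := isClosed_bergmanSpace.completeSpace_coe

instance : CompleteSpace (Bergman n) := inferInstanceAs (CompleteSpace (bergmanSpace n))

/-- The orthogonal projection of `L²` onto the Bergman space. -/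
noncomputable def bergmanProjection : Lp ℂ 2 (ballMeasure n) →L[ℂ] Bergman n :=
  (bergmanSpace n).orthogonalProjectionOnto

/-- The submodule `P` of the functions in the Bergman space that vanish on `M`. -/
def vanishingSubmodule (M : Set (Cn n)) : Submodule ℂ (Bergman n) where
  carrier := {f | ∀ z ∈ M, holo f z = 0}
  add_mem' := by
    intro f g hf hg z hz
    rw [holo_add, hf z hz, hg z hz, add_zero]
  zero_mem' := fun z _ => holo_zero z
  smul_mem' := by
    intro c f hf z hz
    rw [holo_smul, hf z hz, mul_zero]

theorem continuous_holo (z : Cn n) : Continuous fun f : Bergman n => holo f z := by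
  obtain ⟨C, hC⟩ := exists_norm_holo_le z
  let L : Bergman n →ₗ[ℂ] ℂ :=
    { toFun := fun f => holo f z
      map_add' := fun f g => holo_add f g z
      map_smul' := fun c f => holo_smul c f z }
  exact (L.mkContinuous C hC).continuous

theorem isClosed_vanishingSubmodule (M : Set (Cn n)) :
    IsClosed (vanishingSubmodule M : Set (Bergman n)) := by
  have h : (vanishingSubmodule M : Set (Bergman n)) =
      ⋂ z ∈ M, {f | holo f z = 0} := by
    ext f
    simp [vanishingSubmodule]
  rw [h]
  exact isClosed_biInter fun z _ => isClosed_eq (continuous_holo z) continuous_const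

instance (M : Set (Cn n)) : CompleteSpace (vanishingSubmodule M) :=
  (isClosed_vanishingSubmodule M).completeSpace_coe

/-- The Toeplitz operator `f ↦ P(g f)` on the Bergman space with symbol `g ∈ L^∞`, where `P` is
the orthogonal projection of `L²` onto the Bergman space. -/
noncomputable def toeplitzOperator (g : Lp ℂ ∞ (ballMeasure n)) :
    Bergman n →L[ℂ] Bergman n :=
  bergmanProjection ∘L
    (ContinuousLinearMap.mul ℂ ℂ).holderL (ballMeasure n) ∞ 2 2 g ∘L toLp.toContinuousLinearMap

end

/-- The Toeplitz algebra: the `C⋆`-subalgebra of the bounded operators on the Bergman space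
generated by the Toeplitz operators with `L^∞` symbols. (The identity is the Toeplitz operator
with symbol `1`.) -/
noncomputable def toeplitzAlgebra (n : ℕ) :
    StarSubalgebra ℂ (Bergman n →L[ℂ] Bergman n) :=
  (StarAlgebra.adjoin ℂ (Set.range (toeplitzOperator (n := n)))).topologicalClosure

end BergmanBall

open BergmanBall

/-! Let `ν` be `μ` viewed as a measure on the ball. Functions in `P` vanish `μ`-almost everywhere,
and `f` and its projection to `Q` agree on `M`. So the upper bound on `Q` extends to the whole
Bergman space: `ν` is a Carleson measure. The form `∫ |f|² dν` is therefore given by a bounded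
positive operator `T`, which kills `P` and, by the lower bound, satisfies `⟨Tf, f⟩ ≥ c‖f‖²` on `Q`.
Hence `(1 - T/C)^k` is the identity on `P` and decays geometrically on `Q`, so it converges in norm
to the projection onto `P` (`tendsto_one_sub_smul_pow_starProjection`). It remains to see that `T`
lies in the Toeplitz algebra, as the algebra is closed and unital.

That is `mem_toeplitzAlgebra_of_represents`. Each point mass of `ν` is spread uniformly over a small
ellipsoid about it, of hyperbolic size proportional to `r`. The result has a density with respect to
volume, and this density is bounded: at `z` it is dominated by the integral of the squared
normalized reproducing kernel at `z`, on which the Carleson inequality can be tested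
(`cellDensity_le`). So the spread measure gives a Toeplitz operator with bounded symbol. By the mean
value property, the average of `|f|²` over a cell is `|f|²` at the centre plus a variance. The
variance is at most `(K r)²` times the mean of `|f|²` over the cell of radius one, because Bergman
functions are Lipschitz near the origin (`exists_lintegral_cellMap_le`). Integrating over `ν` and
using the density bound at radius one, the two forms differ by at most `(K r)² B ‖f‖²`, so the
Toeplitz operators tend to `T` in norm as `r → 0`. -/

namespace BergmanBall

/-! ### Holomorphic changes of variables and the anisotropic scaling at a point of the ball -/

section Geometry

variable {n : ℕ}

/-- The change of variables formula for injective holomorphic maps. -/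
theorem lintegral_image_eq_lintegral_enorm_det_sq_mul {s : Set (Cn n)} (hs : MeasurableSet s)
    {f : Cn n → Cn n} {f' : Cn n → Cn n →L[ℂ] Cn n} (hf' : ∀ x ∈ s, HasFDerivAt f (f' x) x)
    (hf : Set.InjOn f s) (g : Cn n → ℝ≥0∞) :
    ∫⁻ x in f '' s, g x = ∫⁻ x in s, ‖(f' x).det‖ₑ ^ 2 * g (f x) := by
  rw [lintegral_image_eq_lintegral_abs_det_fderiv_mul volume hs
    (fun x hx => ((hf' x hx).restrictScalars ℝ).hasFDerivWithinAt) hf]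
  refine setLIntegral_congr_fun hs fun x _ => ?_
  -- The real determinant is the norm from `ℂ` to `ℝ` of the complex one.
  have h : ((f' x).restrictScalars ℝ).det = ‖(f' x).det‖ ^ 2 := by
    have := LinearMap.det_restrictScalars (R := ℝ) (f := (f' x : Cn n →ₗ[ℂ] Cn n))
    rw [Algebra.norm_complex_apply, Complex.normSq_eq_norm_sq] at this
    exact this
  simp only [h]
  rw [abs_of_nonneg (by positivity), ENNReal.ofReal_pow (norm_nonneg _), ofReal_norm]

/-- The determinant of a rank one perturbation of a multiple of the identity. -/
theorem det_smul_id_sub_smulRight (c : ℂ) (f : Cn n →L[ℂ] ℂ) (v : Cn n) :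
    (c • (ContinuousLinearMap.id ℂ (Cn n) - f.smulRight v)).det = c ^ n * (1 - f v) := by
  have h : ((c • (ContinuousLinearMap.id ℂ (Cn n) - f.smulRight v) : Cn n →L[ℂ] Cn n) :
      Cn n →ₗ[ℂ] Cn n) = c • LinearMap.transvection (-f : Cn n →ₗ[ℂ] ℂ) v := by
    ext x
    simp [LinearMap.transvection, sub_eq_add_neg]
  rw [ContinuousLinearMap.det, h, LinearMap.det_smul, LinearMap.transvection.det]
  simp [sub_eq_add_neg]

/-- The square root of `1 - ‖w‖²`. -/
noncomputable def defect (w : Cn n) : ℝ := √(1 - ‖w‖ ^ 2)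

theorem defect_nonneg (w : Cn n) : 0 ≤ defect w := Real.sqrt_nonneg _

theorem defect_pos {w : Cn n} (hw : w ∈ unitBall n) : 0 < defect w := by
  rw [mem_ball_zero_iff] at hw
  exact Real.sqrt_pos.2 (by nlinarith [norm_nonneg w])

theorem defect_sq {w : Cn n} (hw : w ∈ unitBall n) : defect w ^ 2 = 1 - ‖w‖ ^ 2 := by
  rw [mem_ball_zero_iff] at hw
  exact Real.sq_sqrt (by nlinarith [norm_nonneg w])

theorem continuous_defect : Continuous (defect (n := n)) := by
  unfold defect
  fun_prop

theorem inner_self_eq_one_sub_defect_sq {w : Cn n} (hw : w ∈ unitBall n) :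
    inner ℂ w w = 1 - (defect w : ℂ) ^ 2 := by
  rw [inner_self_eq_norm_sq_to_K, ← Complex.ofReal_pow, defect_sq hw]
  simp

theorem one_add_defect_ne_zero (w : Cn n) : (1 + defect w : ℂ) ≠ 0 := by
  have := defect_nonneg w
  exact_mod_cast (by positivity : (1 + defect w : ℝ) ≠ 0)

/-- The linear map that contracts by `1 - ‖w‖²` in the direction of `w` and by its square root
in the orthogonal directions. -/
noncomputable def ballScale (w : Cn n) : Cn n →L[ℂ] Cn n :=
  (defect w : ℂ) • (ContinuousLinearMap.id ℂ (Cn n) -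
    ((1 + defect w : ℂ)⁻¹ • innerSL ℂ w).smulRight w)

theorem ballScale_apply (w u : Cn n) :
    ballScale w u = (defect w : ℂ) • (u - ((1 + defect w : ℂ)⁻¹ * inner ℂ w u) • w) := by
  simp [ballScale]

/-- The inverse of `ballScale w`. -/
noncomputable def ballScaleInv (w y : Cn n) : Cn n :=
  (defect w : ℂ)⁻¹ • (y + ((defect w * (1 + defect w) : ℂ)⁻¹ * inner ℂ w y) • w)

/-- The scaling is self-adjoint with eigenvector `w`, whose eigenvalue is `s (1 - (1 - s²) / (1 +
s)) = s²` for `s = defect w`. -/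
theorem inner_ballScale {w : Cn n} (hw : w ∈ unitBall n) (u : Cn n) :
    inner ℂ w (ballScale w u) = (defect w : ℂ) ^ 2 * inner ℂ w u := by
  rw [ballScale_apply, inner_smul_right, inner_sub_right, inner_smul_right,
    inner_self_eq_one_sub_defect_sq hw]
  field_simp [one_add_defect_ne_zero w]
  ring

theorem ballScaleInv_ballScale {w : Cn n} (hw : w ∈ unitBall n) (u : Cn n) :
    ballScaleInv w (ballScale w u) = u := by
  have h0 : (defect w : ℂ) ≠ 0 := by exact_mod_cast (defect_pos hw).ne'
  have h1 := one_add_defect_ne_zero w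
  rw [ballScaleInv, inner_ballScale hw, ballScale_apply, smul_add, smul_smul, smul_smul,
    inv_mul_cancel₀ h0, one_smul, sub_add, sub_eq_self, ← sub_smul]
  convert zero_smul ℂ w
  field_simp
  ring

theorem ballScale_ballScaleInv {w : Cn n} (hw : w ∈ unitBall n) (y : Cn n) :
    ballScale w (ballScaleInv w y) = y := by
  have h0 : (defect w : ℂ) ≠ 0 := by exact_mod_cast (defect_pos hw).ne'
  have h1 := one_add_defect_ne_zero w
  rw [ballScale_apply, ballScaleInv, inner_smul_right, inner_add_right, inner_smul_right,
    inner_self_eq_one_sub_defect_sq hw, smul_sub, smul_smul, smul_smul, mul_inv_cancel₀ h0,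
    one_smul, add_sub_assoc, add_eq_left, ← sub_smul]
  convert zero_smul ℂ w
  field_simp
  ring

theorem ballScale_injective {w : Cn n} (hw : w ∈ unitBall n) :
    Function.Injective (ballScale w) :=
  Function.LeftInverse.injective (ballScaleInv_ballScale hw)

/-- Pythagoras: the part of `u` along `w` is scaled by `s²`, the rest by `s`, and `1 - s² = ‖w‖²`.
-/
theorem norm_ballScale_sq {w : Cn n} (hw : w ∈ unitBall n) (u : Cn n) :
    ‖ballScale w u‖ ^ 2 = defect w ^ 2 * (‖u‖ ^ 2 - ‖inner ℂ w u‖ ^ 2) := by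
  have h1 := one_add_defect_ne_zero w
  have hn : ∀ v : Cn n, ((‖v‖ ^ 2 : ℝ) : ℂ) = inner ℂ v v := fun v => by
    rw [inner_self_eq_norm_sq_to_K]
    simp
  have hc : inner ℂ u w = (starRingEnd ℂ) (inner ℂ w u) := (inner_conj_symm u w).symm
  have hx : ((‖inner ℂ w u‖ ^ 2 : ℝ) : ℂ) = inner ℂ w u * (starRingEnd ℂ) (inner ℂ w u) := by
    rw [Complex.mul_conj, Complex.normSq_eq_norm_sq]
  apply Complex.ofReal_injective
  rw [hn, Complex.ofReal_mul, Complex.ofReal_sub, hn, hx, ballScale_apply]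
  simp only [inner_smul_left, inner_smul_right, inner_sub_left, inner_sub_right, hc,
    inner_self_eq_one_sub_defect_sq hw, map_mul, map_inv₀, map_add, map_one, Complex.conj_ofReal,
    Complex.ofReal_pow]
  field_simp
  ring

theorem det_ballScale {w : Cn n} (hw : w ∈ unitBall n) :
    (ballScale w).det = (defect w : ℂ) ^ (n + 1) := by
  have h1 := one_add_defect_ne_zero w
  rw [ballScale, det_smul_id_sub_smulRight]
  simp only [smul_apply, innerSL_apply_apply,
    inner_self_eq_one_sub_defect_sq hw, smul_eq_mul]
  field_simp
  ring

/-- The factor `defect w ^ 2` comes out of `1 - ‖·‖²`. This one identity keeps both the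
automorphisms and the cells inside the ball. -/
theorem norm_add_ballScale_sq {w : Cn n} (hw : w ∈ unitBall n) (v : Cn n) :
    ‖w + ballScale w v‖ ^ 2 =
      1 - defect w ^ 2 * (1 - 2 * (inner ℂ w v).re - (‖v‖ ^ 2 - ‖inner ℂ w v‖ ^ 2)) := by
  have hre : (inner ℂ w (ballScale w v)).re = defect w ^ 2 * (inner ℂ w v).re := by
    rw [inner_ballScale hw, ← Complex.ofReal_pow, Complex.re_ofReal_mul]
  rw [norm_add_sq (𝕜 := ℂ), RCLike.re_eq_complex_re, hre, norm_ballScale_sq hw, defect_sq hw]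
  ring

/-! ### Automorphisms of the ball and the normalized kernels -/

/-- The automorphism of the ball that moves the origin to `z`. -/
noncomputable def ballAut (z u : Cn n) : Cn n :=
  z + ballScale z ((1 + inner ℂ z u)⁻¹ • u)

theorem norm_inner_lt_one {z u : Cn n} (hz : z ∈ unitBall n) (hu : u ∈ unitBall n) :
    ‖inner ℂ z u‖ < 1 := by
  rw [mem_ball_zero_iff] at hz hu
  exact (norm_inner_le_norm z u).trans_lt (by nlinarith [norm_nonneg z, norm_nonneg u])

theorem one_add_inner_ne_zero {z u : Cn n} (hz : z ∈ unitBall n) (hu : u ∈ unitBall n) :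
    1 + inner ℂ z u ≠ 0 := by
  intro h
  have h1 := norm_inner_lt_one hz hu
  rw [← neg_eq_iff_add_eq_zero.2 h, norm_neg, norm_one] at h1
  exact lt_irrefl _ h1

/-- The reason is `1 - ‖φ(u)‖² = (1 - ‖z‖²)(1 - ‖u‖²) / |1 + ⟨z, u⟩|²` for `φ = ballAut z`. -/
theorem ballAut_mem {z u : Cn n} (hz : z ∈ unitBall n) (hu : u ∈ unitBall n) :
    ballAut z u ∈ unitBall n := by
  have hd := one_add_inner_ne_zero hz hu
  have h := norm_add_ballScale_sq hz ((1 + inner ℂ z u)⁻¹ • u)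
  rw [mem_ball_zero_iff, ← sq_lt_one_iff₀ (norm_nonneg _), ballAut, h, sub_lt_self_iff]
  refine mul_pos (pow_pos (defect_pos hz) 2) ?_
  rw [inner_smul_right, norm_smul, norm_mul, mul_pow, mul_pow, norm_inv, inv_pow]
  rw [mem_ball_zero_iff] at hu
  set x := inner ℂ z u
  have hN : 0 < ‖1 + x‖ ^ 2 := by positivity
  have hre : ((1 + x)⁻¹ * x).re = (‖1 + x‖ ^ 2)⁻¹ * (x.re + ‖x‖ ^ 2) := by
    rw [Complex.inv_def, ← Complex.normSq_eq_norm_sq, ← Complex.normSq_eq_norm_sq,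
      Complex.normSq_apply x]
    simp
    ring
  have hsq : ‖1 + x‖ ^ 2 = 1 + 2 * x.re + ‖x‖ ^ 2 := by
    rw [← Complex.normSq_eq_norm_sq, ← Complex.normSq_eq_norm_sq, Complex.normSq_apply,
      Complex.normSq_apply]
    simp
    ring
  rw [hre]
  have : 1 - 2 * ((‖1 + x‖ ^ 2)⁻¹ * (x.re + ‖x‖ ^ 2)) -
      ((‖1 + x‖ ^ 2)⁻¹ * ‖u‖ ^ 2 - (‖1 + x‖ ^ 2)⁻¹ * ‖x‖ ^ 2) =
      (‖1 + x‖ ^ 2)⁻¹ * (1 - ‖u‖ ^ 2) := by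
    field_simp
    rw [hsq]
    ring
  rw [this]
  exact mul_pos (by positivity) (by nlinarith [norm_nonneg u])

theorem injOn_ballAut {z : Cn n} (hz : z ∈ unitBall n) :
    Set.InjOn (ballAut z) (unitBall n) := by
  intro u hu v hv h
  have h1 := ballScale_injective hz (add_left_cancel h)
  have hu0 := one_add_inner_ne_zero hz hu
  have hv0 := one_add_inner_ne_zero hz hv
  have h2 := congrArg (inner ℂ z) h1
  rw [inner_smul_right, inner_smul_right] at h2
  -- The Möbius map `x ↦ x / (1 + x)` is injective, so the denominators of the two points agree.
  have h3 : inner ℂ z u = inner ℂ z v := by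
    field_simp at h2
    linear_combination h2
  rw [h3] at h1
  exact smul_right_injective _ (inv_ne_zero hv0) h1

/-- The derivative of `ballAut z`. -/
noncomputable def ballAutDeriv (z u : Cn n) : Cn n →L[ℂ] Cn n :=
  ballScale z ∘L ((1 + inner ℂ z u)⁻¹ • (ContinuousLinearMap.id ℂ (Cn n) -
    ((1 + inner ℂ z u)⁻¹ • innerSL ℂ z).smulRight u))

theorem hasFDerivAt_ballAut {z u : Cn n} (hz : z ∈ unitBall n) (hu : u ∈ unitBall n) :
    HasFDerivAt (ballAut z) (ballAutDeriv z u) u := by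
  have hd := one_add_inner_ne_zero hz hu
  have h1 : HasFDerivAt (fun v : Cn n => 1 + inner ℂ z v) (innerSL ℂ z) u :=
    (innerSL ℂ z).hasFDerivAt.const_add 1
  have h2 := ((hasDerivAt_inv hd).comp_hasFDerivAt u h1).smul (hasFDerivAt_id u)
  refine (((ballScale z).hasFDerivAt.comp u h2).const_add z).congr_fderiv ?_
  rw [ballAutDeriv]
  congr 1
  ext1 v
  change (1 + inner ℂ z u)⁻¹ • v + (-((1 + inner ℂ z u) ^ 2)⁻¹ * inner ℂ z v) • u =
    (1 + inner ℂ z u)⁻¹ • (v - ((1 + inner ℂ z u)⁻¹ * inner ℂ z v) • u)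
  generalize 1 + inner ℂ z u = d
  module

theorem det_ballAutDeriv {z u : Cn n} (hz : z ∈ unitBall n) (hu : u ∈ unitBall n) :
    (ballAutDeriv z u).det = ((defect z : ℂ) / (1 + inner ℂ z u)) ^ (n + 1) := by
  have hd := one_add_inner_ne_zero hz hu
  have : (ballAutDeriv z u).det = (ballScale z).det * ((1 + inner ℂ z u)⁻¹ •
      (ContinuousLinearMap.id ℂ (Cn n) -
        ((1 + inner ℂ z u)⁻¹ • innerSL ℂ z).smulRight u)).det :=
    LinearMap.det_comp _ _
  have h1 : 1 - (1 + inner ℂ z u)⁻¹ * inner ℂ z u = (1 + inner ℂ z u)⁻¹ := by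
    field_simp
    ring
  rw [this, det_ballScale hz, det_smul_id_sub_smulRight]
  simp only [smul_apply, innerSL_apply_apply, smul_eq_mul]
  rw [h1]
  ring

/-- The square integrals of the powers of the Cauchy kernel. -/
theorem lintegral_enorm_kernel_le {z : Cn n} (hz : z ∈ unitBall n) :
    ∫⁻ u in unitBall n, ‖((defect z : ℂ) / (1 + inner ℂ z u)) ^ (n + 1)‖ₑ ^ 2 ≤
      volume (unitBall n) := by
  -- The integrand is the real Jacobian of `ballAut z`, so the integral is the volume of an image
  -- contained in the ball; surjectivity is not needed for the bound.
  have h := lintegral_image_eq_lintegral_enorm_det_sq_mul (f := ballAut z) measurableSet_ball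
    (fun u hu => hasFDerivAt_ballAut hz hu) (injOn_ballAut hz) fun _ => 1
  rw [setLIntegral_one] at h
  calc _ = volume (ballAut z '' unitBall n) := by
        rw [h]
        refine setLIntegral_congr_fun measurableSet_ball fun u hu => ?_
        simp only [det_ballAutDeriv hz hu, mul_one]
    _ ≤ _ := by
        refine measure_mono ?_
        rintro _ ⟨u, hu, rfl⟩
        exact ballAut_mem hz hu

/-! ### Ellipsoidal cells comparable to Bergman balls -/

/-- The affine map of the unit ball onto an ellipsoid about `w` that is comparable to a
Bergman ball. -/
noncomputable def cellMap (w u : Cn n) : Cn n := w + ballScale w ((1 / 4 : ℂ) • u)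

theorem norm_quarter_smul (u : Cn n) : ‖(1 / 4 : ℂ) • u‖ = ‖u‖ / 4 := by
  rw [norm_smul]
  simp
  ring

theorem cellMap_zero (w : Cn n) : cellMap w 0 = w := by simp [cellMap]

theorem norm_inner_le_quarter {w v : Cn n} (hw : w ∈ unitBall n) (hv : ‖v‖ ≤ 1 / 4) :
    ‖inner ℂ w v‖ ≤ 1 / 4 := by
  rw [mem_ball_zero_iff] at hw
  exact (norm_inner_le_norm w v).trans (by nlinarith [norm_nonneg w, norm_nonneg v])

theorem defect_sq_mul_le_one_sub_norm_cellMap_sq {w u : Cn n} (hw : w ∈ unitBall n)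
    (hu : ‖u‖ ≤ 1) : defect w ^ 2 * (7 / 16) ≤ 1 - ‖cellMap w u‖ ^ 2 := by
  have hv : ‖(1 / 4 : ℂ) • u‖ ≤ 1 / 4 := by
    rw [norm_quarter_smul]
    linarith
  rw [cellMap, norm_add_ballScale_sq hw, sub_sub_cancel]
  generalize (1 / 4 : ℂ) • u = v at hv
  have hre := (Complex.re_le_norm (inner ℂ w v)).trans (norm_inner_le_quarter hw hv)
  -- With `‖v‖ ≤ 1/4` and `|⟨w, v⟩| ≤ 1/4` the factor is at least `1 - 2/4 - 1/16 = 7/16`.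
  exact mul_le_mul_of_nonneg_left
    (by nlinarith [norm_nonneg v, norm_nonneg (inner ℂ w v)]) (by positivity)

theorem cellMap_mem {w u : Cn n} (hw : w ∈ unitBall n) (hu : ‖u‖ ≤ 1) :
    cellMap w u ∈ unitBall n := by
  have h := defect_sq_mul_le_one_sub_norm_cellMap_sq hw hu
  have := pow_pos (defect_pos hw) 2
  rw [mem_ball_zero_iff, ← sq_lt_one_iff₀ (norm_nonneg _)]
  linarith

theorem defect_sq_mul_le_defect_cellMap_sq {w u : Cn n} (hw : w ∈ unitBall n) (hu : ‖u‖ ≤ 1) :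
    defect w ^ 2 * (7 / 16) ≤ defect (cellMap w u) ^ 2 := by
  rw [defect_sq (cellMap_mem hw hu)]
  exact defect_sq_mul_le_one_sub_norm_cellMap_sq hw hu

/-- Since `1 - ⟨w, w + ballScale w v⟩ = s² (1 - ⟨w, v⟩)` with `s = defect w`, the kernel at a point
of the cell is large at the centre `w`. -/
theorem norm_one_sub_inner_cellMap {w u : Cn n} (hw : w ∈ unitBall n) (hu : ‖u‖ ≤ 1) :
    ‖1 - inner ℂ (cellMap w u) w‖ ≤ defect w ^ 2 * 2 := by
  have hv : ‖(1 / 4 : ℂ) • u‖ ≤ 1 / 4 := by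
    rw [norm_quarter_smul]
    linarith
  have h : ‖1 - inner ℂ (cellMap w u) w‖ = ‖1 - inner ℂ w (cellMap w u)‖ := by
    rw [← inner_conj_symm, ← Complex.norm_conj]
    simp
  rw [h, cellMap]
  generalize (1 / 4 : ℂ) • u = v at hv
  have hx := norm_inner_le_quarter hw hv
  have : 1 - inner ℂ w (w + ballScale w v) = (defect w : ℂ) ^ 2 * (1 - inner ℂ w v) := by
    rw [inner_add_right, inner_ballScale hw, inner_self_eq_one_sub_defect_sq hw]
    ring
  rw [this, norm_mul, norm_pow, Complex.norm_real, Real.norm_of_nonneg (defect_nonneg w)]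
  refine mul_le_mul_of_nonneg_left ((norm_sub_le _ _).trans ?_) (by positivity)
  rw [norm_one]
  linarith

theorem hasFDerivAt_cellMap (w u : Cn n) :
    HasFDerivAt (cellMap w) ((1 / 4 : ℂ) • ballScale w) u := by
  have h := ((1 / 4 : ℂ) • ballScale w).hasFDerivAt (x := u)
  refine (h.const_add w).congr_of_eventuallyEq (Filter.Eventually.of_forall fun v => ?_)
  simp [cellMap]

theorem cellMap_injective {w : Cn n} (hw : w ∈ unitBall n) : Function.Injective (cellMap w) :=
  fun _ _ h => smul_right_injective (Cn n) (by norm_num : (1 / 4 : ℂ) ≠ 0)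
    (ballScale_injective hw (add_left_cancel h))

/-- The real Jacobian of `cellMap w`. -/
noncomputable def cellJacobian (w : Cn n) : ℝ := (4 ^ n)⁻¹ ^ 2 * (defect w ^ 2) ^ (n + 1)

theorem cellJacobian_pos {w : Cn n} (hw : w ∈ unitBall n) : 0 < cellJacobian w := by
  have := defect_pos hw
  unfold cellJacobian
  positivity

theorem enorm_det_cellMap_sq {w : Cn n} (hw : w ∈ unitBall n) :
    ‖((1 / 4 : ℂ) • ballScale w).det‖ₑ ^ 2 = ENNReal.ofReal (cellJacobian w) := by
  have : ((1 / 4 : ℂ) • ballScale w).det = (1 / 4 : ℂ) ^ n * (ballScale w).det := by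
    change LinearMap.det ((1 / 4 : ℂ) • (ballScale w : Cn n →ₗ[ℂ] Cn n)) = _
    rw [LinearMap.det_smul]
    simp [ContinuousLinearMap.det]
  rw [this, det_ballScale hw, ← ofReal_norm, ← ENNReal.ofReal_pow (norm_nonneg _)]
  congr 1
  rw [norm_mul, norm_pow, norm_pow, Complex.norm_real, Real.norm_of_nonneg (defect_nonneg w),
    cellJacobian]
  simp
  ring

/-- The image of the closed ball of radius `r` under `cellMap w`. -/
def cell (r : ℝ) (w : Cn n) : Set (Cn n) := {z | ‖ballScaleInv w (z - w)‖ ≤ r / 4}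

theorem cellMap_image {w : Cn n} (hw : w ∈ unitBall n) (r : ℝ) :
    cellMap w '' closedBall 0 r = cell r w := by
  ext z
  constructor
  · rintro ⟨u, hu, rfl⟩
    rw [mem_closedBall_zero_iff] at hu
    rw [cell, Set.mem_ofPred_eq, cellMap, add_sub_cancel_left, ballScaleInv_ballScale hw,
      norm_quarter_smul]
    linarith
  · intro hz
    refine ⟨(4 : ℂ) • ballScaleInv w (z - w), ?_, ?_⟩
    · rw [cell, Set.mem_ofPred_eq] at hz
      rw [mem_closedBall_zero_iff, norm_smul]
      simp
      linarith
    · rw [cellMap, smul_smul]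
      norm_num [ballScale_ballScaleInv hw]

theorem cell_subset {w : Cn n} (hw : w ∈ unitBall n) {r : ℝ} (hr : r ≤ 1) :
    cell r w ⊆ unitBall n := by
  rw [← cellMap_image hw]
  rintro _ ⟨u, hu, rfl⟩
  exact cellMap_mem hw ((mem_closedBall_zero_iff.1 hu).trans hr)

/-- Tonelli needs measurability jointly in centre and point. The description by the explicit formula
`ballScaleInv` gives it, where an image under `cellMap` would not do so directly. -/
theorem measurableSet_cell_prod (r : ℝ) :
    MeasurableSet {p : Cn n × Cn n | p.2 ∈ cell r p.1} := by
  have hd : Measurable fun p : Cn n × Cn n => (defect p.1 : ℂ) :=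
    Complex.measurable_ofReal.comp (continuous_defect.measurable.comp measurable_fst)
  have hsub : Measurable fun p : Cn n × Cn n => p.2 - p.1 := measurable_snd.sub measurable_fst
  have h : Measurable fun p : Cn n × Cn n => ballScaleInv p.1 (p.2 - p.1) := by
    unfold ballScaleInv
    exact hd.inv.smul (hsub.add (((hd.mul (measurable_const.add hd)).inv.mul
      (measurable_fst.inner hsub)).smul measurable_fst))
  exact measurableSet_le h.norm measurable_const

theorem measurableSet_cell (r : ℝ) (w : Cn n) : MeasurableSet (cell r w) :=
  measurable_prodMk_left (measurableSet_cell_prod r)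

/-- The change of variables by `cellMap w`. -/
theorem lintegral_cell {w : Cn n} (hw : w ∈ unitBall n) (r : ℝ) (g : Cn n → ℝ≥0∞) :
    ∫⁻ u in closedBall 0 r, g (cellMap w u) =
      (ENNReal.ofReal (cellJacobian w))⁻¹ * ∫⁻ z in cell r w, g z := by
  have hJ : ENNReal.ofReal (cellJacobian w) ≠ 0 := by simpa using cellJacobian_pos hw
  rw [← cellMap_image hw, lintegral_image_eq_lintegral_enorm_det_sq_mul measurableSet_closedBall
    (fun u _ => hasFDerivAt_cellMap w u) (cellMap_injective hw).injOn]
  simp only [enorm_det_cellMap_sq hw]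
  rw [lintegral_const_mul' _ _ ENNReal.ofReal_ne_top, ← mul_assoc,
    ENNReal.inv_mul_cancel hJ ENNReal.ofReal_ne_top, one_mul]

end Geometry

/-! ### Norms, oscillation and variance of Bergman functions -/

section FunctionTheory

variable {n : ℕ}

theorem measurable_holo (f : Bergman n) : Measurable (holo f) := by
  refine measurable_of_restrict_of_restrict_compl (s := unitBall n) measurableSet_ball ?_ ?_
  · exact (continuousOn_iff_continuous_domRestrict.1
      (holo_differentiableOn f).continuousOn).measurable
  · convert measurable_const (a := (0 : ℂ)) with z
    exact holo_of_notMem f z.2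

/-- The norm of the Bergman space as an integral. -/
theorem lintegral_enorm_holo_sq (f : Bergman n) :
    ∫⁻ z, ‖holo f z‖ₑ ^ 2 ∂(ballMeasure n) = ‖f‖ₑ ^ 2 := by
  have h : ‖f‖ₑ = eLpNorm (toLp f) 2 (ballMeasure n) := by
    rw [← Lp.enorm_def]
    exact (toLp (n := n)).enorm_map f |>.symm
  rw [h, eLpNorm_congr_ae (ae_eq_holo f), eLpNorm_eq_lintegral_rpow_enorm_toReal (by norm_num)
    (by norm_num)]
  rw [← ENNReal.rpow_natCast, ← ENNReal.rpow_mul]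
  simp

theorem exists_bergman_of_differentiableOn {F : Cn n → ℂ} (hF : DifferentiableOn ℂ F (unitBall n))
    (hfin : ∫⁻ z, ‖F z‖ₑ ^ 2 ∂(ballMeasure n) ≠ ∞) :
    ∃ f : Bergman n, ∀ z ∈ unitBall n, holo f z = F z := by
  have hm : AEStronglyMeasurable F (ballMeasure n) :=
    (hF.continuousOn.aestronglyMeasurable measurableSet_ball).smul_measure _
  have hL : MemLp F 2 (ballMeasure n) := by
    refine ⟨hm, ?_⟩
    rw [eLpNorm_lt_top_iff_lintegral_rpow_enorm_lt_top (by norm_num) (by norm_num)]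
    simpa using hfin.lt_top
  let f : Bergman n := ⟨hL.toLp F, F, hF, hL.coeFn_toLp⟩
  exact ⟨f, fun z hz => holo_eq_of_ae_eq f hF hL.coeFn_toLp hz⟩

theorem lintegral_ballMeasure (g : Cn n → ℝ≥0∞) :
    ∫⁻ z, g z ∂(ballMeasure n) = (volume (unitBall n))⁻¹ * ∫⁻ z in unitBall n, g z := by
  rw [ballMeasure, lintegral_smul_measure, smul_eq_mul]

/-- Functions in the Bergman space are Lipschitz near the origin. -/
theorem exists_norm_holo_sub_holo_zero_le (n : ℕ) :
    ∃ K : ℝ, 0 < K ∧ ∀ (h : Bergman n) (u : Cn n), ‖u‖ ≤ 1 / 4 →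
      ‖holo h u - holo h 0‖ ≤ K * ‖h‖ * ‖u‖ := by
  -- This is the derivative bound for radius `1/4`, valid as points of norm at most `1/4` have
  -- distance more than `1/2` from the sphere; the added `1` makes positivity immediate.
  refine ⟨volume.real (unitBall n) / volume.real (closedBall (0 : Cn n) (1 / 4)) / (1 / 4) + 1,
    by positivity, fun h u hu => ?_⟩
  have hsub : ∀ z ∈ closedBall (0 : Cn n) (1 / 4), closedBall z (1 / 4 + 1 / 4) ⊆ unitBall n := by
    intro z hz
    refine (closedBall_subset_closedBall' (ε₂ := 3 / 4) ?_).trans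
      (closedBall_subset_ball (by norm_num))
    linarith [mem_closedBall.1 hz]
  have := (convex_closedBall (0 : Cn n) (1 / 4)).norm_image_sub_le_of_norm_fderiv_le (𝕜 := ℂ)
    (f := holo h) (fun z hz => (holo_differentiableOn h).differentiableAt
      (isOpen_ball.mem_nhds (hsub z hz (mem_closedBall_self (by norm_num)))))
    (fun z hz => norm_fderiv_holo_le h (by norm_num) (hsub z hz))
    (mem_closedBall_self (by norm_num)) (mem_closedBall_zero_iff.2 hu)
  rw [sub_zero] at this
  refine this.trans ?_
  rw [add_mul, add_mul]
  have : 0 ≤ 1 * ‖h‖ * ‖u‖ := by positivity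
  have h2 := mul_nonneg (norm_nonneg h) (norm_nonneg u)
  ring_nf
  ring_nf at h2
  linarith

/-- The mean of the square of a holomorphic function over a ball is the square of its value at
the centre plus the variance. -/
theorem lintegral_enorm_sq_eq_add {h : Cn n → ℂ} (hh : DifferentiableOn ℂ h (unitBall n)) {r : ℝ}
    (hr1 : r < 1) :
    ∫⁻ u in closedBall 0 r, ‖h u‖ₑ ^ 2 = volume (closedBall (0 : Cn n) r) * ‖h 0‖ₑ ^ 2 +
      ∫⁻ u in closedBall 0 r, ‖h u - h 0‖ₑ ^ 2 := by
  have hsub : closedBall (0 : Cn n) r ⊆ unitBall n := closedBall_subset_ball hr1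
  have hc : ContinuousOn h (closedBall 0 r) := hh.continuousOn.mono hsub
  have hK : IsCompact (closedBall (0 : Cn n) r) := isCompact_closedBall 0 r
  have hconv : ∀ g : Cn n → ℂ, ContinuousOn g (closedBall 0 r) →
      ∫⁻ u in closedBall 0 r, ‖g u‖ₑ ^ 2 =
        ENNReal.ofReal (∫ u in closedBall (0 : Cn n) r, ‖g u‖ ^ 2) := by
    intro g hg
    have hi : IntegrableOn (fun u => ‖g u‖ ^ 2) (closedBall 0 r) :=
      (hg.norm.pow 2).integrableOn_compact hK
    rw [ofReal_integral_eq_lintegral_ofReal hi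
      (Filter.Eventually.of_forall fun _ => by positivity)]
    simp [ENNReal.ofReal_pow]
  have hmv := mean_value hh hsub
  simp only [zero_add] at hmv
  have hd0 : ∫ u in closedBall (0 : Cn n) r, (h u - h 0) = 0 := by
    rw [integral_sub (hc.integrableOn_compact hK)
      (continuousOn_const.integrableOn_compact hK), hmv, setIntegral_const]
    simp
  -- The cross term has integral zero by the mean value property.
  have hexp : ∀ u, ‖h u‖ ^ 2 = ‖h 0‖ ^ 2 + ‖h u - h 0‖ ^ 2 +
      2 * ((starRingEnd ℂ) (h 0) * (h u - h 0)).re := by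
    intro u
    rw [← Complex.normSq_eq_norm_sq, ← Complex.normSq_eq_norm_sq, ← Complex.normSq_eq_norm_sq,
      Complex.normSq_apply, Complex.normSq_apply, Complex.normSq_apply]
    simp
    ring
  have hcd : ContinuousOn (fun u => h u - h 0) (closedBall 0 r) := hc.sub continuousOn_const
  have hi : IntegrableOn (fun u => (starRingEnd ℂ) (h 0) * (h u - h 0)) (closedBall 0 r) :=
    (continuousOn_const.mul hcd).integrableOn_compact hK
  have hi' : ∫ u in closedBall (0 : Cn n) r,
      ((starRingEnd ℂ) (h 0) * (h u - h 0)).re = 0 := by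
    have := integral_re hi
    simp only [RCLike.re_eq_complex_re] at this
    rw [this, integral_const_mul, hd0]
    simp
  have key : ∫ u in closedBall (0 : Cn n) r, ‖h u‖ ^ 2 =
      volume.real (closedBall (0 : Cn n) r) * ‖h 0‖ ^ 2 +
        ∫ u in closedBall (0 : Cn n) r, ‖h u - h 0‖ ^ 2 := by
    have hA : IntegrableOn (fun u : Cn n => ‖h 0‖ ^ 2 + ‖h u - h 0‖ ^ 2) (closedBall 0 r) :=
      (continuousOn_const.add (hcd.norm.pow 2)).integrableOn_compact hK
    have hB : IntegrableOn (fun u : Cn n => ‖h u - h 0‖ ^ 2) (closedBall 0 r) :=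
      (hcd.norm.pow 2).integrableOn_compact hK
    have hR : IntegrableOn (fun u : Cn n => 2 * ((starRingEnd ℂ) (h 0) * (h u - h 0)).re)
      (closedBall 0 r) := hi.re.const_mul 2
    rw [integral_congr_ae (Filter.Eventually.of_forall hexp), integral_add hA hR, integral_const_mul, hi', integral_add
      (continuousOn_const.integrableOn_compact hK) hB]
    simp
  rw [hconv h hc, hconv _ hcd, key, ENNReal.ofReal_add (by positivity) (by positivity),
    ENNReal.ofReal_mul measureReal_nonneg, Measure.real,
    ENNReal.ofReal_toReal measure_closedBall_lt_top.ne, ENNReal.ofReal_pow (norm_nonneg _),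
    ofReal_norm]

end FunctionTheory

/-! ### Spreading a Carleson measure over cells: boundedness of the density -/

section Carleson

variable {n : ℕ}

/-- The density at `z` of the normalized volume measure of the cell of radius `r` about `w`. -/
noncomputable def cellWeight (r : ℝ) (w z : Cn n) : ℝ≥0∞ :=
  (cell r w).indicator (fun _ => (ENNReal.ofReal (cellJacobian w))⁻¹) z

/-- The density of the measure that arises from `ν` when every point mass is spread over the cell
of radius `r` about it. -/
noncomputable def cellDensity (ν : Measure (Cn n)) (r : ℝ) (z : Cn n) : ℝ≥0∞ :=
  ∫⁻ w, cellWeight r w z ∂ν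

theorem continuous_cellJacobian : Continuous (cellJacobian (n := n)) := by
  unfold cellJacobian
  exact continuous_const.mul ((continuous_defect.pow 2).pow (n + 1))

theorem measurable_cellWeight (r : ℝ) :
    Measurable fun p : Cn n × Cn n =>
      cellWeight r p.1 p.2 := by
  have h : Measurable fun p : Cn n × Cn n => (ENNReal.ofReal (cellJacobian p.1))⁻¹ := by
    have h1 : Measurable fun p : Cn n × Cn n => cellJacobian p.1 :=
      continuous_cellJacobian.measurable.comp measurable_fst
    exact h1.ennreal_ofReal.inv
  exact h.indicator (measurableSet_cell_prod r)

theorem measurable_cellDensity (ν : Measure (Cn n)) [SFinite ν] (r : ℝ) :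
    Measurable (cellDensity ν r) :=
  (measurable_cellWeight r).lintegral_prod_left'

/-- Change variables in each cell, then apply Tonelli: averaging over cells and integrating against
`ν` amounts to integrating against the spread density. -/
theorem lintegral_lintegral_cellMap {ν : Measure (Cn n)} [SFinite ν]
    (hν : ∀ᵐ w ∂ν, w ∈ unitBall n) {r : ℝ} (hr : r ≤ 1) {φ : Cn n → ℝ≥0∞} (hφ : Measurable φ) :
    ∫⁻ w, (∫⁻ u in closedBall 0 r, φ (cellMap w u)) ∂ν =
      ∫⁻ z in unitBall n, φ z * cellDensity ν r z := by
  have h : ∀ᵐ w ∂ν, ∫⁻ u in closedBall 0 r, φ (cellMap w u) = ∫⁻ z in unitBall n,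
      φ z * cellWeight r w z := by
    filter_upwards [hν] with w hw
    have hJ : (ENNReal.ofReal (cellJacobian w))⁻¹ ≠ ∞ := by simpa using cellJacobian_pos hw
    rw [lintegral_cell hw, ← lintegral_const_mul' _ _ hJ]
    nth_rewrite 1 [← Set.inter_eq_self_of_subset_left (cell_subset hw hr)]
    rw [← setLIntegral_indicator (measurableSet_cell r w)]
    refine lintegral_congr fun z => ?_
    by_cases hz : z ∈ cell r w <;> simp [cellWeight, hz, mul_comm]
  rw [lintegral_congr_ae h, lintegral_lintegral_swap]
  · refine lintegral_congr fun z => ?_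
    have hm : Measurable fun w : Cn n => cellWeight r w z :=
      (measurable_cellWeight r).of_uncurry_right
    rw [lintegral_const_mul _ hm]
    rfl
  · exact ((hφ.comp measurable_snd).mul (measurable_cellWeight r)).aemeasurable

/-- The normalized reproducing kernels. -/
theorem exists_kernel {z : Cn n} (hz : z ∈ unitBall n) :
    ∃ f : Bergman n, ‖f‖ₑ ^ 2 ≤ 1 ∧
      ∀ w ∈ unitBall n, holo f w = ((defect z : ℂ) / (1 - inner ℂ z w)) ^ (n + 1) := by
  -- The Jacobian of `ballAut` has denominator `1 + ⟨z, ·⟩`, so the kernel at `z` comes from the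
  -- automorphism for `-z`.
  have hz' : -z ∈ unitBall n := by
    rw [mem_ball_zero_iff] at hz ⊢
    rwa [norm_neg]
  have hne : ∀ w ∈ unitBall n, 1 - inner ℂ z w ≠ 0 := fun w hw => by
    simpa [inner_neg_left, ← sub_eq_add_neg] using one_add_inner_ne_zero hz' hw
  have hle := lintegral_enorm_kernel_le hz'
  have hd : defect (-z) = defect z := by simp [defect]
  simp only [hd, inner_neg_left, ← sub_eq_add_neg] at hle
  set F : Cn n → ℂ := fun w => ((defect z : ℂ) / (1 - inner ℂ z w)) ^ (n + 1) with hF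
  have hle' : ∫⁻ w, ‖F w‖ₑ ^ 2 ∂(ballMeasure n) ≤ 1 := by
    rw [lintegral_ballMeasure]
    exact (mul_le_mul_right hle _).trans_eq
      (ENNReal.inv_mul_cancel (volume_unitBall_ne_zero n) (volume_unitBall_ne_top n))
  have hdiff : DifferentiableOn ℂ F (unitBall n) := by
    have h1 : DifferentiableOn ℂ (fun w => 1 - inner ℂ z w) (unitBall n) :=
      ((innerSL ℂ z).differentiable.const_sub 1).differentiableOn
    have h2 : DifferentiableOn ℂ (fun _ : Cn n => (defect z : ℂ)) (unitBall n) :=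
      differentiableOn_const _
    have h3 := (h2.mul (h1.inv hne)).pow (n + 1)
    exact h3.congr fun w _ => by simp [hF, div_eq_mul_inv]
  obtain ⟨f, hf⟩ := exists_bergman_of_differentiableOn hdiff (hle'.trans_lt ENNReal.one_lt_top).ne
  refine ⟨f, ?_, hf⟩
  rw [← lintegral_enorm_holo_sq]
  refine le_of_eq_of_le (lintegral_congr_ae (ae_ballMeasure_iff.2 ?_)) hle'
  filter_upwards [ae_restrict_mem measurableSet_ball] with w hw
  rw [hf w hw]

/-- On the cells that contain `z` the normalized reproducing kernel at `z` is large. -/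
theorem cellWeight_le {w z : Cn n} (hw : w ∈ unitBall n) {r : ℝ} (hr : r ≤ 1) :
    cellWeight r w z ≤
      ENNReal.ofReal ((4 ^ n) ^ 2 * (64 / 7) ^ (n + 1)) *
        ‖((defect z : ℂ) / (1 - inner ℂ z w)) ^ (n + 1)‖ₑ ^ 2 := by
  by_cases hz : z ∈ cell r w
  swap
  · simp [cellWeight, hz]
  rw [cellWeight, Set.indicator_of_mem hz, ← ENNReal.ofReal_inv_of_pos (cellJacobian_pos hw), ← ofReal_norm,
    ← ENNReal.ofReal_pow (norm_nonneg _), ← ENNReal.ofReal_mul (by positivity)]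
  refine ENNReal.ofReal_le_ofReal ?_
  rw [← cellMap_image hw] at hz
  obtain ⟨u, hu, rfl⟩ := hz
  have hu1 : ‖u‖ ≤ 1 := (mem_closedBall_zero_iff.1 hu).trans hr
  have h1 := defect_sq_mul_le_defect_cellMap_sq hw hu1
  have h2 := norm_one_sub_inner_cellMap hw hu1
  have hz := cellMap_mem hw hu1
  have hdw := defect_pos hw
  have hne : 0 < ‖1 - inner ℂ (cellMap w u) w‖ := by
    rw [norm_pos_iff, sub_ne_zero]
    intro h
    have := norm_inner_lt_one hz hw
    rw [← h, norm_one] at this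
    exact lt_irrefl _ this
  rw [norm_pow, norm_div, Complex.norm_real, Real.norm_of_nonneg (defect_nonneg _), cellJacobian,
    pow_right_comm (_ / _), mul_inv, inv_pow (4 ^ n : ℝ), inv_inv, mul_assoc, ← mul_pow, ← inv_pow]
  refine mul_le_mul_of_nonneg_left (pow_le_pow_left₀ (by positivity) ?_ _) (by positivity)
  rw [div_pow, mul_div_assoc', le_div_iff₀ (by positivity), inv_mul_le_iff₀ (by positivity)]
  -- The constant `64/7` is `2²` divided by the ratio `7/16` between the squared defects at the
  -- centre and in the cell.
  calc ‖1 - inner ℂ (cellMap w u) w‖ ^ 2 ≤ (defect w ^ 2 * 2) ^ 2 :=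
        pow_le_pow_left₀ (norm_nonneg _) h2 2
    _ = defect w ^ 2 * (64 / 7 * (defect w ^ 2 * (7 / 16))) := by ring
    _ ≤ _ := by gcongr

/-- Carleson measures have bounded densities over cells. -/
theorem cellDensity_le {ν : Measure (Cn n)} (hν : ∀ᵐ w ∂ν, w ∈ unitBall n) {C : ℝ≥0∞}
    (hC : ∀ f : Bergman n, ∫⁻ w, ‖holo f w‖ₑ ^ 2 ∂ν ≤ C * ‖f‖ₑ ^ 2) {r : ℝ} (hr : r ≤ 1)
    {z : Cn n} (hz : z ∈ unitBall n) :
    cellDensity ν r z ≤ ENNReal.ofReal ((4 ^ n) ^ 2 * (64 / 7) ^ (n + 1)) * C := by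
  -- The Carleson inequality is tested on the normalized kernel at `z`, whose square dominates the
  -- weight at `z` of every cell up to a constant.
  obtain ⟨f, hf1, hf⟩ := exists_kernel hz
  calc cellDensity ν r z
      ≤ ∫⁻ w, ENNReal.ofReal ((4 ^ n) ^ 2 * (64 / 7) ^ (n + 1)) * ‖holo f w‖ₑ ^ 2 ∂ν := by
        refine lintegral_mono_ae ?_
        filter_upwards [hν] with w hw
        rw [hf w hw]
        exact cellWeight_le hw hr
    _ = _ * ∫⁻ w, ‖holo f w‖ₑ ^ 2 ∂ν := lintegral_const_mul' _ _ ENNReal.ofReal_ne_top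
    _ ≤ _ := by
        gcongr
        refine (hC f).trans ?_
        calc C * ‖f‖ₑ ^ 2 ≤ C * 1 := by gcongr
          _ = C := mul_one C

end Carleson

/-! ### Operators of quadratic forms, Toeplitz operators and norm comparison -/

section Operators

variable {n : ℕ}

/-- A positive operator represents the square integrals with respect to `ν`. -/
def Represents (T : Bergman n →L[ℂ] Bergman n) (ν : Measure (Cn n)) : Prop :=
  T.IsPositive ∧
    ∀ f : Bergman n, ENNReal.ofReal (inner ℂ (T f) f).re = ∫⁻ w, ‖holo f w‖ₑ ^ 2 ∂ν

/-- The positive operator of a Carleson measure. -/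
theorem exists_represents {ν : Measure (Cn n)} {C : ℝ≥0∞} (hCtop : C ≠ ∞)
    (hC : ∀ f : Bergman n, ∫⁻ w, ‖holo f w‖ₑ ^ 2 ∂ν ≤ C * ‖f‖ₑ ^ 2) :
    ∃ T : Bergman n →L[ℂ] Bergman n, Represents T ν ∧
      ∀ f : Bergman n, ∫⁻ w, ‖holo f w‖ₑ ^ 2 ∂ν = 0 → T f = 0 := by
  have hsq : ∀ f : Bergman n, eLpNorm (holo f) 2 ν ^ 2 = ∫⁻ w, ‖holo f w‖ₑ ^ 2 ∂ν := by
    intro f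
    rw [eLpNorm_eq_lintegral_rpow_enorm_toReal (by norm_num) (by norm_num),
      ← ENNReal.rpow_natCast, ← ENNReal.rpow_mul]
    simp
  have hmem : ∀ f : Bergman n, MemLp (holo f) 2 ν := by
    intro f
    refine ⟨(measurable_holo f).aestronglyMeasurable, ?_⟩
    have h : eLpNorm (holo f) 2 ν ^ 2 < ∞ := by
      rw [hsq]
      exact (hC f).trans_lt (ENNReal.mul_lt_top hCtop.lt_top (by simp))
    simpa using h
  let J₀ : Bergman n →ₗ[ℂ] Lp ℂ 2 ν :=
    { toFun := fun f => (hmem f).toLp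
      map_add' := fun f g => by
        rw [← MemLp.toLp_add]
        exact MemLp.toLp_congr _ _ (Filter.Eventually.of_forall (holo_add f g))
      map_smul' := fun c f => by
        rw [RingHom.id_apply, ← MemLp.toLp_const_smul]
        exact MemLp.toLp_congr _ _ (Filter.Eventually.of_forall (holo_smul c f)) }
  have hJ₀ : ∀ f, ‖J₀ f‖ₑ ^ 2 = ∫⁻ w, ‖holo f w‖ₑ ^ 2 ∂ν := by
    intro f
    rw [← hsq]
    congr 1
    exact Lp.enorm_toLp (hmem f)
  have hreal : ∀ {E : Type} [NormedAddCommGroup E] (x : E),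
      ENNReal.ofReal (‖x‖ ^ 2) = ‖x‖ₑ ^ 2 := fun x => by
    rw [ENNReal.ofReal_pow (norm_nonneg _), ofReal_norm]
  let J : Bergman n →L[ℂ] Lp ℂ 2 ν := J₀.mkContinuous √C.toReal fun f => by
    refine le_of_sq_le_sq ?_ (by positivity)
    rw [mul_pow, Real.sq_sqrt ENNReal.toReal_nonneg, ← ENNReal.ofReal_le_ofReal_iff
      (by positivity), ENNReal.ofReal_mul ENNReal.toReal_nonneg, ENNReal.ofReal_toReal hCtop,
      hreal, hreal, hJ₀]
    exact hC f
  -- `J` is the restriction map into `L²(ν)`, bounded by the Carleson inequality.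
  refine ⟨J.adjoint ∘L J, ⟨ContinuousLinearMap.isPositive_adjoint_comp_self J, fun f => ?_⟩,
    fun f hf => ?_⟩
  · rw [ContinuousLinearMap.comp_apply, ContinuousLinearMap.adjoint_inner_left,
      ← RCLike.re_eq_complex_re, inner_self_eq_norm_sq, hreal]
    exact hJ₀ f
  · have hJf : J₀ f = 0 := by
      have := (hJ₀ f).trans hf
      simpa using this
    change J.adjoint (J₀ f) = 0
    rw [hJf, map_zero]

theorem inner_toeplitzOperator (t : Lp ℂ ∞ (ballMeasure n)) (f : Bergman n) :
    inner ℂ (toeplitzOperator t f) f =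
      ∫ z, (starRingEnd ℂ) (t z) * (‖holo f z‖ ^ 2 : ℝ) ∂(ballMeasure n) := by
  have h1 : inner ℂ (toeplitzOperator t f) f =
      inner ℂ ((ContinuousLinearMap.mul ℂ ℂ).holderL (ballMeasure n) ∞ 2 2 t (toLp f))
        (toLp f) :=
    Submodule.inner_orthogonalProjectionOnto_eq_of_mem_right (K := bergmanSpace n) f _
  rw [h1, L2.inner_def]
  refine integral_congr_ae ?_
  filter_upwards [ContinuousLinearMap.coeFn_holder (r := 2) (ContinuousLinearMap.mul ℂ ℂ) t
    (toLp f), ae_eq_holo f] with z hz hz2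
  change inner ℂ (((ContinuousLinearMap.mul ℂ ℂ).holder 2 t (toLp f) : Cn n → ℂ) z) _ = _
  rw [hz, hz2, ContinuousLinearMap.mul_apply', RCLike.inner_apply, map_mul,
    ← Complex.normSq_eq_norm_sq, Complex.normSq_eq_conj_mul_self]
  ring

/-- The Toeplitz operators with bounded positive symbols. -/
theorem exists_toeplitzOperator_represents {g : Cn n → ℝ≥0∞} (hg : Measurable g) {B : ℝ≥0∞}
    (hB : B ≠ ∞) (hgB : ∀ z ∈ unitBall n, g z ≤ B) :
    ∃ t, Represents (toeplitzOperator t) ((ballMeasure n).withDensity g) := by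
  have hae : ∀ᵐ z ∂(ballMeasure n), g z ≤ B := ae_ballMeasure_iff.2 <| by
    filter_upwards [ae_restrict_mem measurableSet_ball] with z hz using hgB z hz
  have hmeas : Measurable fun z => ((g z).toReal : ℂ) :=
    Complex.measurable_ofReal.comp hg.ennreal_toReal
  have hL : MemLp (fun z => ((g z).toReal : ℂ)) ∞ (ballMeasure n) := by
    refine memLp_top_of_bound hmeas.aestronglyMeasurable B.toReal ?_
    filter_upwards [hae] with z hz
    rw [Complex.norm_real, Real.norm_of_nonneg ENNReal.toReal_nonneg]
    exact ENNReal.toReal_mono hB hz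
  have hinner : ∀ f : Bergman n, inner ℂ (toeplitzOperator (hL.toLp _) f) f =
      ((∫ z, (g z).toReal * ‖holo f z‖ ^ 2 ∂(ballMeasure n) : ℝ) : ℂ) := by
    intro f
    rw [inner_toeplitzOperator, ← integral_complex_ofReal]
    refine integral_congr_ae ?_
    filter_upwards [hL.coeFn_toLp] with z hz
    rw [hz, Complex.conj_ofReal, ← Complex.ofReal_mul]
  have hnn : ∀ f : Bergman n, 0 ≤ ∫ z, (g z).toReal * ‖holo f z‖ ^ 2 ∂(ballMeasure n) :=
    fun f => integral_nonneg fun z => by positivity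
  refine ⟨hL.toLp _, ?_, fun f => ?_⟩
  · rw [ContinuousLinearMap.isPositive_iff_complex]
    intro f
    rw [hinner]
    exact ⟨by simp, hnn f⟩
  · have hlt : ∀ᵐ z ∂(ballMeasure n), g z < ∞ := hae.mono fun z hz => hz.trans_lt hB.lt_top
    have hfm : Measurable fun z => ‖holo f z‖ₑ ^ 2 := (measurable_holo f).enorm.pow_const 2
    have hpt : ∀ᵐ z ∂(ballMeasure n),
        ENNReal.ofReal ((g z).toReal * ‖holo f z‖ ^ 2) = g z * ‖holo f z‖ₑ ^ 2 := by
      filter_upwards [hlt] with z hz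
      rw [ENNReal.ofReal_mul ENNReal.toReal_nonneg, ENNReal.ofReal_toReal hz.ne,
        ENNReal.ofReal_pow (norm_nonneg _), ofReal_norm]
    have hm : Measurable fun z => (g z).toReal * ‖holo f z‖ ^ 2 :=
      hg.ennreal_toReal.mul ((measurable_holo f).norm.pow_const 2)
    rw [hinner, Complex.ofReal_re, integral_eq_lintegral_of_nonneg_ae
      (Filter.Eventually.of_forall fun z => by positivity) hm.aestronglyMeasurable,
      lintegral_congr_ae hpt, lintegral_withDensity_eq_lintegral_mul _ hg hfm,
      ENNReal.ofReal_toReal]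
    · rfl
    · refine ne_top_of_le_ne_top (b := B * ‖f‖ₑ ^ 2) (ENNReal.mul_ne_top hB (by simp)) ?_
      rw [← lintegral_enorm_holo_sq, ← lintegral_const_mul' _ _ hB]
      refine lintegral_mono_ae ?_
      filter_upwards [hae] with z hz
      gcongr

/-- Two represented quadratic forms that are close give operators that are close in norm. -/
theorem norm_sub_le_of_represents {S T : Bergman n →L[ℂ] Bergman n} {σ ν : Measure (Cn n)}
    (hS : Represents S σ) (hT : Represents T ν) {ε : ℝ} (hε : 0 ≤ ε)
    (hle : ∀ f : Bergman n, ∫⁻ w, ‖holo f w‖ₑ ^ 2 ∂ν ≤ ∫⁻ w, ‖holo f w‖ₑ ^ 2 ∂σ)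
    (hge : ∀ f : Bergman n, ∫⁻ w, ‖holo f w‖ₑ ^ 2 ∂σ ≤
      ∫⁻ w, ‖holo f w‖ₑ ^ 2 ∂ν + ENNReal.ofReal (ε * ‖f‖ ^ 2)) :
    ‖S - T‖ ≤ ε := by
  have hS0 : ∀ f, 0 ≤ (inner ℂ (S f) f).re := fun f => hS.1.re_inner_nonneg_left f
  have hT0 : ∀ f, 0 ≤ (inner ℂ (T f) f).re := fun f => hT.1.re_inner_nonneg_left f
  -- The forms give `0 ≤ S - T ≤ ε` in the order of operators, and the norm is monotone on positive
  -- elements of a `C⋆`-algebra.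
  have h1 : 0 ≤ S - T := by
    rw [ContinuousLinearMap.nonneg_iff_isPositive, ContinuousLinearMap.isPositive_def']
    refine ⟨hS.1.isSelfAdjoint.sub hT.1.isSelfAdjoint, fun f => ?_⟩
    have h := hle f
    rw [← hS.2, ← hT.2, ENNReal.ofReal_le_ofReal_iff (hS0 f)] at h
    rw [ContinuousLinearMap.reApplyInnerSelf_apply, sub_apply, inner_sub_left,
      map_sub]
    exact sub_nonneg.2 h
  have h2 : S - T ≤ algebraMap ℝ (Bergman n →L[ℂ] Bergman n) ε := by
    rw [ContinuousLinearMap.le_def, ContinuousLinearMap.isPositive_def']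
    refine ⟨(IsSelfAdjoint.algebraMap _ (IsSelfAdjoint.all ε)).sub
      (hS.1.isSelfAdjoint.sub hT.1.isSelfAdjoint), fun f => ?_⟩
    have h := hge f
    rw [← hS.2, ← hT.2, ← ENNReal.ofReal_add (hT0 f) (by positivity),
      ENNReal.ofReal_le_ofReal_iff (add_nonneg (hT0 f) (by positivity))] at h
    have h3 : (inner ℂ (algebraMap ℝ (Bergman n →L[ℂ] Bergman n) ε f) f).re = ε * ‖f‖ ^ 2 := by
      have : algebraMap ℝ (Bergman n →L[ℂ] Bergman n) ε f = (ε : ℂ) • f := rfl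
      rw [this, inner_smul_left, Complex.conj_ofReal, Complex.re_ofReal_mul,
        ← RCLike.re_eq_complex_re, inner_self_eq_norm_sq]
    rw [ContinuousLinearMap.reApplyInnerSelf_apply, sub_apply, sub_apply, inner_sub_left,
      inner_sub_left, map_sub, map_sub]
    simp only [RCLike.re_eq_complex_re, h3]
    linarith
  refine (CStarAlgebra.norm_le_norm_of_nonneg_of_le h1 h2).trans ?_
  refine ContinuousLinearMap.opNorm_le_bound _ hε fun f => ?_
  have : algebraMap ℝ (Bergman n →L[ℂ] Bergman n) ε f = (ε : ℂ) • f := rfl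
  rw [this, norm_smul, Complex.norm_real, Real.norm_of_nonneg hε]

end Operators

/-! ### Norm approximation of Carleson operators by Toeplitz operators -/

section CarlesonToeplitz

variable {n : ℕ}

theorem differentiableOn_holo_cellMap (f : Bergman n) {w : Cn n} (hw : w ∈ unitBall n) :
    DifferentiableOn ℂ (fun u => holo f (cellMap w u)) (unitBall n) :=
  (holo_differentiableOn f).comp
    (fun _ _ => (hasFDerivAt_cellMap w _).differentiableAt.differentiableWithinAt)
    fun _ hu => cellMap_mem hw (mem_ball_zero_iff.1 hu).le

theorem mul_enorm_holo_sq_le_lintegral_cellMap (f : Bergman n) {w : Cn n} (hw : w ∈ unitBall n)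
    {r : ℝ} (hr : r < 1) :
    volume (closedBall (0 : Cn n) r) * ‖holo f w‖ₑ ^ 2 ≤
      ∫⁻ u in closedBall 0 r, ‖holo f (cellMap w u)‖ₑ ^ 2 := by
  rw [lintegral_enorm_sq_eq_add (differentiableOn_holo_cellMap f hw) hr, cellMap_zero]
  exact le_self_add

/-- The mean square of a function over a small cell is close to the square of its value at the
centre. -/
theorem exists_lintegral_cellMap_le (n : ℕ) :
    ∃ K : ℝ, 0 < K ∧ ∀ (f : Bergman n), ∀ w ∈ unitBall n, ∀ r : ℝ, 0 < r → r ≤ 1 / 4 →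
      ∫⁻ u in closedBall 0 r, ‖holo f (cellMap w u)‖ₑ ^ 2 ≤
        volume (closedBall (0 : Cn n) r) * (‖holo f w‖ₑ ^ 2 + ENNReal.ofReal ((K * r) ^ 2) *
          ∫⁻ u, ‖holo f (cellMap w u)‖ₑ ^ 2 ∂(ballMeasure n)) := by
  obtain ⟨K, hK, hosc⟩ := exists_norm_holo_sub_holo_zero_le n
  refine ⟨K, hK, fun f w hw r hr hr4 => ?_⟩
  have hV0 : volume (closedBall (0 : Cn n) r) ≠ 0 := (measure_closedBall_pos volume _ hr).ne'
  have hKr : ENNReal.ofReal ((K * r) ^ 2) ≠ 0 := by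
    rw [Ne, ENNReal.ofReal_eq_zero, not_le]
    positivity
  -- With an infinite integral the bound is trivial; otherwise `f ∘ cellMap w` is itself a Bergman
  -- function, to which the Lipschitz estimate at the origin applies.
  rcases eq_or_ne (∫⁻ u, ‖holo f (cellMap w u)‖ₑ ^ 2 ∂(ballMeasure n)) ∞ with htop | hfin
  · rw [htop, ENNReal.mul_top hKr, add_top, ENNReal.mul_top hV0]
    exact le_top
  have hd := differentiableOn_holo_cellMap f hw
  obtain ⟨h, hh⟩ := exists_bergman_of_differentiableOn hd hfin
  have hnorm : ∫⁻ u, ‖holo f (cellMap w u)‖ₑ ^ 2 ∂(ballMeasure n) = ‖h‖ₑ ^ 2 := by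
    rw [← lintegral_enorm_holo_sq]
    refine lintegral_congr_ae (ae_ballMeasure_iff.2 ?_)
    filter_upwards [ae_restrict_mem measurableSet_ball] with u hu
    rw [hh u hu]
  rw [lintegral_enorm_sq_eq_add hd (hr4.trans_lt (by norm_num)), cellMap_zero, hnorm, mul_add]
  gcongr
  calc _ ≤ ∫⁻ u in closedBall (0 : Cn n) r, ENNReal.ofReal ((K * r) ^ 2) * ‖h‖ₑ ^ 2 := by
        refine setLIntegral_mono measurable_const fun u hu => ?_
        rw [mem_closedBall_zero_iff] at hu
        have hub : u ∈ unitBall n := mem_ball_zero_iff.2 (by linarith)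
        have h0 := hh 0 (mem_ball_self one_pos)
        simp only [cellMap_zero] at h0
        rw [← h0, ← hh u hub, ← ofReal_norm, ← ofReal_norm,
          ← ENNReal.ofReal_pow (norm_nonneg _), ← ENNReal.ofReal_pow (norm_nonneg _),
          ← ENNReal.ofReal_mul (by positivity), ← mul_pow]
        refine ENNReal.ofReal_le_ofReal (pow_le_pow_left₀ (norm_nonneg _) ?_ 2)
        calc _ ≤ K * ‖h‖ * ‖u‖ := hosc h u (hu.trans hr4)
          _ ≤ K * ‖h‖ * r := by gcongr
          _ = K * r * ‖h‖ := by ring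
    _ = _ := by rw [setLIntegral_const, mul_comm]

/-- The operators of Carleson measures belong to the Toeplitz algebra. -/
theorem mem_toeplitzAlgebra_of_represents {ν : Measure (Cn n)} [SFinite ν]
    (hν : ∀ᵐ w ∂ν, w ∈ unitBall n) {C : ℝ≥0∞} (hCtop : C ≠ ∞)
    (hC : ∀ f : Bergman n, ∫⁻ w, ‖holo f w‖ₑ ^ 2 ∂ν ≤ C * ‖f‖ₑ ^ 2)
    {T : Bergman n →L[ℂ] Bergman n} (hT : Represents T ν) : T ∈ toeplitzAlgebra n := by
  obtain ⟨K, hK, hcell⟩ := exists_lintegral_cellMap_le n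
  set B : ℝ≥0∞ := ENNReal.ofReal ((4 ^ n) ^ 2 * (64 / 7) ^ (n + 1)) * C
  have hB : B ≠ ∞ := ENNReal.mul_ne_top ENNReal.ofReal_ne_top hCtop
  set V := volume (unitBall n)
  have hV0 : V ≠ 0 := volume_unitBall_ne_zero n
  have hVtop : V ≠ ∞ := volume_unitBall_ne_top n
  -- The total error is controlled by the mean squares over the cells of radius one, which are
  -- summable because the spread density at radius one is bounded by `B`.
  have hsum : ∀ f : Bergman n,
      ∫⁻ w, (∫⁻ u, ‖holo f (cellMap w u)‖ₑ ^ 2 ∂(ballMeasure n)) ∂ν ≤ B * ‖f‖ₑ ^ 2 := by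
    intro f
    have hm : Measurable fun z => ‖holo f z‖ₑ ^ 2 := (measurable_holo f).enorm.pow_const 2
    calc _ ≤ ∫⁻ w, V⁻¹ * (∫⁻ u in closedBall 0 1, ‖holo f (cellMap w u)‖ₑ ^ 2) ∂ν := by
          refine lintegral_mono fun w => ?_
          rw [lintegral_ballMeasure]
          gcongr
          exact ball_subset_closedBall
      _ = V⁻¹ * ∫⁻ z in unitBall n, ‖holo f z‖ₑ ^ 2 * cellDensity ν 1 z := by
          rw [lintegral_const_mul' _ _ (by simpa using hV0),
            lintegral_lintegral_cellMap hν le_rfl hm]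
      _ ≤ V⁻¹ * ∫⁻ z in unitBall n, B * ‖holo f z‖ₑ ^ 2 := by
          refine mul_le_mul_right (setLIntegral_mono (hm.const_mul _) fun z hz => ?_) _
          rw [mul_comm]
          exact mul_le_mul_left (cellDensity_le hν hC le_rfl hz) _
      _ = B * ‖f‖ₑ ^ 2 := by
          rw [lintegral_const_mul _ hm, ← lintegral_enorm_holo_sq, lintegral_ballMeasure]
          ring
  rw [toeplitzAlgebra, ← SetLike.mem_coe, StarSubalgebra.topologicalClosure_coe,
    Metric.mem_closure_iff]
  intro ε hε
  obtain ⟨r, hr, hr4, hrε⟩ : ∃ r : ℝ, 0 < r ∧ r ≤ 1 / 4 ∧ (K * r) ^ 2 * B.toReal < ε := by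
    have hlim : Filter.Tendsto (fun r : ℝ => (K * r) ^ 2 * B.toReal) (nhdsWithin 0 (Set.Ioi 0))
        (nhds ((K * 0) ^ 2 * B.toReal)) :=
      (Continuous.tendsto (by fun_prop) 0).mono_left nhdsWithin_le_nhds
    have h0 : (K * 0) ^ 2 * B.toReal < ε := by simpa using hε
    have h1 := hlim.eventually (gt_mem_nhds h0)
    have h2 : ∀ᶠ r : ℝ in nhdsWithin 0 (Set.Ioi 0), r ∈ Set.Ioc 0 (1 / 4) :=
      Ioc_mem_nhdsGT (by norm_num)
    obtain ⟨r, hr1, hr2⟩ := (h1.and h2).exists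
    exact ⟨r, hr2.1, hr2.2, hr1⟩
  set W := volume (closedBall (0 : Cn n) r)
  have hW0 : W ≠ 0 := (measure_closedBall_pos volume _ hr).ne'
  have hWtop : W ≠ ∞ := measure_closedBall_lt_top.ne
  -- The factor `W⁻¹` turns cell integrals into averages, and `V` undoes the normalization of
  -- `ballMeasure`.
  have hgm : Measurable fun z => V * W⁻¹ * cellDensity ν r z :=
    (measurable_cellDensity ν r).const_mul _
  obtain ⟨t, ht⟩ := exists_toeplitzOperator_represents hgm (B := V * W⁻¹ * B)
    (ENNReal.mul_ne_top (ENNReal.mul_ne_top hVtop (by simpa using hW0)) hB)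
    fun z hz => mul_le_mul_right (cellDensity_le hν hC (hr4.trans (by norm_num)) hz) _
  have hform : ∀ f : Bergman n,
      ∫⁻ z, ‖holo f z‖ₑ ^ 2 ∂((ballMeasure n).withDensity fun z => V * W⁻¹ * cellDensity ν r z) =
        ∫⁻ w, W⁻¹ * (∫⁻ u in closedBall 0 r, ‖holo f (cellMap w u)‖ₑ ^ 2) ∂ν := by
    intro f
    have hm : Measurable fun z => ‖holo f z‖ₑ ^ 2 := (measurable_holo f).enorm.pow_const 2
    rw [lintegral_withDensity_eq_lintegral_mul _ hgm hm, lintegral_ballMeasure,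
      lintegral_const_mul' _ _ (by simpa using hW0),
      lintegral_lintegral_cellMap hν (hr4.trans (by norm_num)) hm,
      ← lintegral_const_mul' _ _ (by simpa using hV0),
      ← lintegral_const_mul' _ _ (by simpa using hW0)]
    refine lintegral_congr fun z => ?_
    rw [Pi.mul_apply]
    calc V⁻¹ * (V * W⁻¹ * cellDensity ν r z * ‖holo f z‖ₑ ^ 2)
        = V⁻¹ * V * (W⁻¹ * (‖holo f z‖ₑ ^ 2 * cellDensity ν r z)) := by ring
      _ = _ := by rw [ENNReal.inv_mul_cancel hV0 hVtop, one_mul]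
  refine ⟨toeplitzOperator t, StarAlgebra.subset_adjoin ℂ _ ⟨t, rfl⟩, ?_⟩
  rw [dist_comm, dist_eq_norm]
  refine (norm_sub_le_of_represents ht hT (by positivity) (fun f => ?_) fun f => ?_).trans_lt hrε
  · rw [hform]
    refine lintegral_mono_ae ?_
    filter_upwards [hν] with w hw
    rw [mul_comm, ← div_eq_mul_inv, ENNReal.le_div_iff_mul_le (Or.inl hW0) (Or.inl hWtop), mul_comm]
    exact mul_enorm_holo_sq_le_lintegral_cellMap f hw (hr4.trans_lt (by norm_num))
  · rw [hform]
    have hm : Measurable fun z => ‖holo f z‖ₑ ^ 2 := (measurable_holo f).enorm.pow_const 2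
    calc _ ≤ ∫⁻ w, (‖holo f w‖ₑ ^ 2 + ENNReal.ofReal ((K * r) ^ 2) *
          ∫⁻ u, ‖holo f (cellMap w u)‖ₑ ^ 2 ∂(ballMeasure n)) ∂ν := by
          refine lintegral_mono_ae ?_
          filter_upwards [hν] with w hw
          rw [mul_comm, ← div_eq_mul_inv]
          refine ENNReal.div_le_of_le_mul ?_
          rw [mul_comm]
          exact hcell f w hw r hr hr4
      _ ≤ _ := by
          rw [lintegral_add_left hm, lintegral_const_mul' _ _ ENNReal.ofReal_ne_top, mul_assoc,
            ENNReal.ofReal_mul (by positivity), ENNReal.ofReal_mul ENNReal.toReal_nonneg,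
            ENNReal.ofReal_toReal hB, ENNReal.ofReal_pow (norm_nonneg _), ofReal_norm]
          gcongr
          exact hsum f

end CarlesonToeplitz

/-! ### The projection onto a kernel as a limit of powers -/

section Projection

/-- The projection onto the kernel of a positive operator that is bounded below on the orthogonal
complement of its kernel is a limit of polynomials in the operator. -/
theorem tendsto_one_sub_smul_pow_starProjection {E : Type*} [NormedAddCommGroup E]
    [InnerProductSpace ℂ E] [CompleteSpace E] {K : Submodule ℂ E} [K.HasOrthogonalProjection]
    {T : E →L[ℂ] E} (hT : T.IsPositive) (hK : ∀ f ∈ K, T f = 0) {c C : ℝ} (hc : 0 < c)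
    (hcC : c ≤ C) (hlow : ∀ f ∈ Kᗮ, c * ‖f‖ ^ 2 ≤ (inner ℂ (T f) f).re)
    (hup : ∀ f ∈ Kᗮ, (inner ℂ (T f) f).re ≤ C * ‖f‖ ^ 2) :
    Filter.Tendsto (fun k : ℕ => (1 - (C⁻¹ : ℂ) • T) ^ k) Filter.atTop
      (nhds K.starProjection) := by
  have hC : 0 < C := hc.trans_le hcC
  set p := K.starProjection
  set q := Kᗮ.starProjection with hq
  have hpq : 1 = p + q := by
    rw [hq, Submodule.starProjection_orthogonal']
    abel
  have hTp : T * p = 0 := by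
    ext f
    exact hK _ (K.starProjection_apply_mem f)
  have hpsa : star p = p := isSelfAdjoint_starProjection K
  have hpT : p * T = 0 := by
    have h := congrArg star hTp
    rwa [star_mul, hpsa, hT.isSelfAdjoint.star_eq, star_zero] at h
  have hpp : p * p = p := K.isIdempotentElem_starProjection
  set A := q - (C⁻¹ : ℂ) • T with hA
  have hqe : q = 1 - p := by rw [hpq]; abel
  have hpA : p * A = 0 := by
    rw [hA, hqe, mul_sub, mul_sub, mul_one, hpp, mul_smul_comm, hpT]
    simp
  have hAp : A * p = 0 := by
    rw [hA, hqe, sub_mul, sub_mul, one_mul, hpp, smul_mul_assoc, hTp]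
    simp
  -- The exponent is shifted because `A ^ 0 = 1` rather than `q`.
  have hpow : ∀ k : ℕ, (1 - (C⁻¹ : ℂ) • T) ^ (k + 1) = p + A ^ (k + 1) := by
    have h1 : 1 - (C⁻¹ : ℂ) • T = p + A := by
      rw [hA, hqe]
      abel
    intro k
    induction k with
    | zero => simpa using h1
    | succ k ih =>
      rw [pow_succ, ih, h1, add_mul, mul_add, mul_add, hpp, hpA, pow_succ A k, mul_assoc, hAp,
        mul_zero, pow_succ A (k + 1), pow_succ A k]
      abel
  have hAq : ∀ f, (inner ℂ (A f) f).re = ‖q f‖ ^ 2 - C⁻¹ * (inner ℂ (T (q f)) (q f)).re := by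
    intro f
    have hqf : (inner ℂ (q f) f).re = ‖q f‖ ^ 2 :=
      Submodule.re_inner_starProjection_eq_normSq (K := Kᗮ) f
    have hdec : f = p f + q f := DFunLike.congr_fun hpq f
    have hpf : T (p f) = 0 := hK _ (K.starProjection_apply_mem f)
    have hTq : inner ℂ (T f) f = inner ℂ (T (q f)) (q f) := by
      have h1 : T f = T (q f) := by
        conv_lhs => rw [hdec, map_add, hpf, zero_add]
      have h2 : inner ℂ (T (q f)) (p f) = 0 := by
        rw [hT.inner_left_eq_inner_right, hpf, inner_zero_right]
      rw [h1]
      conv_lhs => rw [hdec, inner_add_right]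
      rw [← hdec, h2, zero_add]
    rw [hA, sub_apply, smul_apply, inner_sub_left, inner_smul_left, hTq, Complex.sub_re, hqf,
      ← Complex.ofReal_inv, Complex.conj_ofReal, Complex.re_ofReal_mul]
  have hqmem : ∀ f, q f ∈ Kᗮ := fun f => Kᗮ.starProjection_apply_mem f
  have hqn : ∀ f, ‖q f‖ ≤ ‖f‖ := fun f => Kᗮ.norm_starProjection_apply_le f
  have hAsa : IsSelfAdjoint A := by
    refine IsSelfAdjoint.sub (isSelfAdjoint_starProjection Kᗮ)
      (IsSelfAdjoint.smul ?_ hT.isSelfAdjoint)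
    rw [← Complex.ofReal_inv]
    exact Complex.conj_ofReal _
  have hA0 : 0 ≤ A := by
    rw [ContinuousLinearMap.nonneg_iff_isPositive, ContinuousLinearMap.isPositive_def']
    refine ⟨hAsa, fun f => ?_⟩
    rw [ContinuousLinearMap.reApplyInnerSelf_apply, RCLike.re_eq_complex_re, hAq, sub_nonneg,
      inv_mul_le_iff₀ hC]
    exact hup _ (hqmem f)
  have hρ : 0 ≤ 1 - c / C := sub_nonneg.2 ((div_le_one hC).2 hcC)
  have hA1 : A ≤ algebraMap ℝ (E →L[ℂ] E) (1 - c / C) := by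
    rw [ContinuousLinearMap.le_def, ContinuousLinearMap.isPositive_def']
    refine ⟨(IsSelfAdjoint.algebraMap _ (IsSelfAdjoint.all _)).sub hAsa, fun f => ?_⟩
    have h3 : (inner ℂ (algebraMap ℝ (E →L[ℂ] E) (1 - c / C) f) f).re =
        (1 - c / C) * ‖f‖ ^ 2 := by
      have : algebraMap ℝ (E →L[ℂ] E) (1 - c / C) f = ((1 - c / C : ℝ) : ℂ) • f := rfl
      rw [this, inner_smul_left, Complex.conj_ofReal, Complex.re_ofReal_mul,
        ← RCLike.re_eq_complex_re, inner_self_eq_norm_sq]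
    rw [ContinuousLinearMap.reApplyInnerSelf_apply, sub_apply, inner_sub_left,
      RCLike.re_eq_complex_re, Complex.sub_re, h3, hAq, sub_nonneg]
    have h4 : c / C * ‖q f‖ ^ 2 ≤ C⁻¹ * (inner ℂ (T (q f)) (q f)).re := by
      rw [div_mul_eq_mul_div, div_eq_inv_mul]
      exact mul_le_mul_of_nonneg_left (hlow _ (hqmem f)) (by positivity)
    have h5 : (1 - c / C) * ‖q f‖ ^ 2 ≤ (1 - c / C) * ‖f‖ ^ 2 :=
      mul_le_mul_of_nonneg_left (pow_le_pow_left₀ (norm_nonneg _) (hqn f) 2) hρ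
    linarith
  have hAn : ‖A‖ < 1 := by
    refine ((CStarAlgebra.norm_le_norm_of_nonneg_of_le hA0 hA1).trans ?_).trans_lt
      (sub_lt_self 1 (div_pos hc hC))
    refine ContinuousLinearMap.opNorm_le_bound _ hρ fun f => ?_
    have : algebraMap ℝ (E →L[ℂ] E) (1 - c / C) f = ((1 - c / C : ℝ) : ℂ) • f := rfl
    rw [this, norm_smul, Complex.norm_real, Real.norm_of_nonneg hρ]
  rw [← Filter.tendsto_add_atTop_iff_nat 1]
  simp only [hpow]
  have hlim := ((tendsto_pow_atTop_nhds_zero_of_norm_lt_one hAn).comp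
    (Filter.tendsto_add_atTop_nat 1)).const_add p
  rwa [add_zero] at hlim

end Projection

end BergmanBall

/-! ### The main theorem -/

open BergmanBall

theorem corollary3p2 (n : ℕ) (M : Set (Cn n)) (hM : M ⊆ unitBall n)
    (μ : Measure M) [IsFiniteMeasure μ] [μ.Regular]
    (hμ : ∃ c C : ℝ, 0 < c ∧ 0 < C ∧ ∀ f ∈ (vanishingSubmodule M)ᗮ,
      ENNReal.ofReal (c * ‖f‖ ^ 2) ≤ ∫⁻ w : M, ‖holo f w‖ₑ ^ 2 ∂μ ∧
      ∫⁻ w : M, ‖holo f w‖ₑ ^ 2 ∂μ ≤ ENNReal.ofReal (C * ‖f‖ ^ 2)) :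
    (vanishingSubmodule M).starProjection ∈ toeplitzAlgebra n ∧
      ((vanishingSubmodule M)ᗮ).starProjection ∈ toeplitzAlgebra n := by
  obtain ⟨c, C, hc, hC, h⟩ := hμ
  set P := vanishingSubmodule M
  -- The set `M` need not be measurable: only the inclusion map and the ball are used as measurable
  -- objects.
  set ν : Measure (Cn n) := μ.map Subtype.val
  have hint : ∀ f : Bergman n,
      ∫⁻ w, ‖holo f w‖ₑ ^ 2 ∂ν = ∫⁻ w : M, ‖holo f w‖ₑ ^ 2 ∂μ := fun f =>
    lintegral_map ((measurable_holo f).enorm.pow_const 2) measurable_subtype_coe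
  have hν : ∀ᵐ w ∂ν, w ∈ unitBall n :=
    (ae_map_iff measurable_subtype_coe.aemeasurable measurableSet_ball).2
      (Filter.Eventually.of_forall fun w => hM w.2)
  have hvanish : ∀ f ∈ P, ∫⁻ w, ‖holo f w‖ₑ ^ 2 ∂ν = 0 := by
    intro f hf
    rw [hint, ← lintegral_zero]
    refine lintegral_congr fun w => ?_
    rw [hf w w.2]
    simp
  have hCarleson : ∀ f : Bergman n,
      ∫⁻ w, ‖holo f w‖ₑ ^ 2 ∂ν ≤ ENNReal.ofReal C * ‖f‖ₑ ^ 2 := by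
    intro f
    -- So `f` and its projection onto `Q` agree on `M`, and the upper bound on `Q` passes to `f`.
    have hf : f - Pᗮ.starProjection f ∈ P := by
      rw [Submodule.starProjection_orthogonal', sub_apply, one_apply_eq_self,
        sub_sub_cancel]
      exact P.starProjection_apply_mem f
    have heq : ∫⁻ w, ‖holo f w‖ₑ ^ 2 ∂ν = ∫⁻ w, ‖holo (Pᗮ.starProjection f) w‖ₑ ^ 2 ∂ν := by
      rw [hint, hint]
      refine lintegral_congr fun w => ?_
      have := hf w w.2
      rw [holo_sub, sub_eq_zero] at this
      rw [this]
    rw [heq, hint]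
    refine (h _ (Pᗮ.starProjection_apply_mem f)).2.trans ?_
    rw [← ofReal_norm, ← ENNReal.ofReal_pow (norm_nonneg _), ← ENNReal.ofReal_mul hC.le]
    refine ENNReal.ofReal_le_ofReal (mul_le_mul_of_nonneg_left ?_ hC.le)
    exact pow_le_pow_left₀ (norm_nonneg _) (Pᗮ.norm_starProjection_apply_le f) 2
  obtain ⟨T, hT, hker⟩ := exists_represents ENNReal.ofReal_ne_top hCarleson
  have hTmem : T ∈ toeplitzAlgebra n :=
    mem_toeplitzAlgebra_of_represents hν ENNReal.ofReal_ne_top hCarleson hT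
  have hT0 : ∀ f, 0 ≤ (inner ℂ (T f) f).re := fun f => hT.1.re_inner_nonneg_left f
  -- If `Q = 0` the hypotheses do not force `c ≤ C`; the maximum supplies it and remains an upper
  -- constant.
  have hlim := tendsto_one_sub_smul_pow_starProjection (C := max c C) hT.1
    (fun f hf => hker f (hvanish f hf)) hc
    (le_max_left c C)
    (fun f hf => by
      have h1 := (h f hf).1
      rwa [← hint, ← hT.2, ENNReal.ofReal_le_ofReal_iff (hT0 f)] at h1)
    (fun f hf => by
      have h1 := (h f hf).2
      rw [← hint, ← hT.2, ENNReal.ofReal_le_ofReal_iff (by positivity)] at h1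
      exact h1.trans (mul_le_mul_of_nonneg_right (le_max_right c C) (by positivity)))
  have hPmem : P.starProjection ∈ toeplitzAlgebra n := by
    refine (StarSubalgebra.isClosed_topologicalClosure _).mem_of_tendsto hlim
      (Filter.Eventually.of_forall fun k => ?_)
    exact pow_mem (sub_mem (one_mem _) (SMulMemClass.smul_mem _ hTmem)) k
  refine ⟨hPmem, ?_⟩
  rw [Submodule.starProjection_orthogonal']
  exact sub_mem (one_mem _) hPmem
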